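/- **Theorem (Time-discrete energy stability).** Let $d\ge 1$ and let $\Omega\subset\mathbb R^d$ be a bounded open set whose boundary is locally a Lipschitz graph, except possibly at a closed set of vanishing $(d-1)$-dimensional Hausdorff measure (for instance a bounded Lipschitz domain or a polyhedral domain). Let $\tilde f=\tilde f(\rho,\varphi)$ be a real function, let $\mathbf S=\mathbf S(\varphi,\mathbf A)\in\mathbb R^{d\times d}$ ($\varphi\in\mathbb R$, $\mathbf A\in\mathbb R^{d\times d}$) be continuous, let $\gamma,\eta\in\mathbb R$, and let $0=t_0<t_1<\dots<t_N$, $\Delta t_n=t_{n+1}-t_n$. For iterates write $\Phi^{n+\frac12}=\tfrac12(\Phi^{n+1}+\Phi^n)$. Let $(\rho^n,\mathbf v^n,\varphi^n,\mu^n,\tau^n,\boldsymbol\sigma^n)$, $0\le n\le N$, be of class $C^1(\bar\Omega)$ with values in $\mathbb R\times\mathbb R^d\times\mathbb R\times\mathbb R\times\mathbb R\times\mathbb R^d$, with $\rho^n>0$ in $\Omega$, with $\mathbf v^n=0$ on $\partial\Omega$ and $\boldsymbol\sigma^n\cdot\mathbf n=0$ at every boundary point that has an outward unit normal $\mathbf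 n$, with $\boldsymbol\sigma^0=\nabla\varphi^0$ in $\Omega$, and such that for $n=0,\dots,N-1$ the following equations hold in $\Omega$: $$\begin{aligned} 0&=\frac{\rho^{n+1}-\rho^n}{\Delta t_n}+\operatorname{div}(\rho^{n+\frac12}\mathbf v^{n+\frac12}),\\ 0&=\rho^{n+\frac12}\,\frac{\mathbf v^{n+1}-\mathbf v^n}{\Delta t_n}+\operatorname{div}(\rho^{n+\frac12}\mathbf v^{n+\frac12}\otimes\mathbf v^{n+\frac12})-\operatorname{div}(\rho^{n+\frac12}\mathbf v^{n+\frac12})\mathbf v^{n+\frac12}-\tfrac12\rho^{n+\frac12}\nabla|\mathbf v^{n+\frac12}|^2\\ &\quad+\rho^{n+\frac12}\nabla\tau^{n+\frac12}-\mu^{n+\frac12}\nabla\varphi^{n+\frac12}-\operatorname{div}\mathbf S(\varphi^{n+\frac12},\nabla\mathbf v^{n+\frac12}),\\ 0&=\frac{\varphi^{n+1}-\varphi^n}{\Delta t_n}+\nabla\varphi^{n+\frac12}\cdot\mathbf v^{n+\frac12}+\eta\,\frac{\mu^{n+\frac12}}{\rho^{n+\frac12}},\\ 0&=\mu^{n+\frac12}-\frac{\rho^{n+1}\tilde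 f(\rho^{n+1},\varphi^{n+1})-\rho^{n+1}\tilde f(\rho^{n+1},\varphi^n)+\rho^n\tilde f(\rho^n,\varphi^{n+1})-\rho^n\tilde f(\rho^n,\varphi^n)}{2(\varphi^{n+1}-\varphi^n)}+\gamma\operatorname{div}\boldsymbol\sigma^{n+\frac12},\\ 0&=\tau^{n+\frac12}-\frac{\rho^{n+1}\tilde f(\rho^{n+1},\varphi^{n+1})-\rho^n\tilde f(\rho^n,\varphi^{n+1})+\rho^{n+1}\tilde f(\rho^{n+1},\varphi^n)-\rho^n\tilde f(\rho^n,\varphi^n)}{2(\rho^{n+1}-\rho^n)}-\tfrac14\left(|\mathbf v^{n+1}|^2+|\mathbf v^n|^2\right),\\ 0&=\boldsymbol\sigma^{n+1}-\nabla\varphi^{n+1}. \end{aligned}$$ Here matrix divergences are taken row-wise and $(\nabla\mathbf v)_{ij}=\partial_jv_i$; $\operatorname{div}\mathbf S$ is the weak divergence, and the second equation is required almost everywhere; the fourth (fifth) equation is required only at the points where $\varphi^{n+1}\ne\varphi^n$ ($\rho^{n+1}\neq\rho^n$), so that any convention for the difference quotient is allowed elsewhere. Suppose that $\rho^0\tilde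 f(\rho^0,\varphi^0)$ is integrable over $\Omega$. Then for every $n\in\{0,\dots,N\}$ all integrands below are integrable over $\Omega$ and $$\begin{aligned} &\int_\Omega\rho^n\tilde f(\rho^n,\varphi^n)+\tfrac12\rho^n|\mathbf v^n|^2+\tfrac\gamma2|\boldsymbol\sigma^n|^2\,d\mathbf x =\int_\Omega\rho^0\tilde f(\rho^0,\varphi^0)+\tfrac12\rho^0|\mathbf v^0|^2+\tfrac\gamma2|\boldsymbol\sigma^0|^2\,d\mathbf x\\ &\qquad-\sum_{j=0}^{n-1}\Delta t_j\int_\Omega\mathbf S(\varphi^{j+\frac12},\nabla\mathbf v^{j+\frac12}):\nabla\mathbf v^{j+\frac12}+\eta\,\frac{|\mu^{j+\frac12}|^2}{\rho^{j+\frac12}}\,d\mathbf x. \end{aligned}$$ -/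

import Mathlib

open MeasureTheory
open scoped ContDiff

namespace NSAC

/-- The space `ℝ^d` with the Euclidean norm. -/
abbrev E (d : ℕ) : Type := EuclideanSpace ℝ (Fin d)

noncomputable section

/-! ### Differential operators -/

/-- The `j`-th partial derivative of a scalar function. -/
def pderiv {d : ℕ} (j : Fin d) (u : E d → ℝ) (x : E d) : ℝ :=
  fderiv ℝ u x (EuclideanSpace.single j 1)

/-- The divergence `∑ⱼ ∂ⱼ uⱼ` of a vector field. -/
def divergence {d : ℕ} (u : E d → E d) (x : E d) : ℝ :=
  ∑ j, pderiv j (fun y => u y j) x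

/-- The row-wise divergence `(∑ⱼ ∂ⱼ Mᵢⱼ)ᵢ` of a matrix field. -/
def tensorDivergence {d : ℕ} (M : E d → Matrix (Fin d) (Fin d) ℝ) (x : E d) : E d :=
  WithLp.toLp 2 fun i => ∑ j, pderiv j (fun y => M y i j) x

/-- The Jacobian matrix `(∂ⱼ vᵢ)ᵢⱼ` of a vector field. -/
def jacobian {d : ℕ} (v : E d → E d) (x : E d) : Matrix (Fin d) (Fin d) ℝ :=
  Matrix.of fun i j => pderiv j (fun y => v y i) x

/-- The tensor product `(aᵢ bⱼ)ᵢⱼ` of two vectors. -/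
def tensor {d : ℕ} (a b : E d) : Matrix (Fin d) (Fin d) ℝ :=
  Matrix.of fun i j => a i * b j

/-- The Frobenius product `A : B = ∑ᵢⱼ Aᵢⱼ Bᵢⱼ`. -/
def frob {d : ℕ} (A B : Matrix (Fin d) (Fin d) ℝ) : ℝ :=
  ∑ i, ∑ j, A i j * B i j

/-- `D` is the weak (distributional) row-wise divergence of the matrix field `M` in `Ω`:
`∫ D · X = - ∫ M : ∇X` for every smooth vector field `X` with compact support in `Ω`. -/
structure IsWeakTensorDivergence {d : ℕ} (Ω : Set (E d))
    (M : E d → Matrix (Fin d) (Fin d) ℝ) (D : E d → E d) : Prop where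
  locallyIntegrable_field : ∀ i j, LocallyIntegrableOn (fun x => M x i j) Ω
  locallyIntegrable_div : LocallyIntegrableOn D Ω
  integral_eq : ∀ X : E d → E d, ContDiff ℝ ∞ X → HasCompactSupport X → tsupport X ⊆ Ω →
    ∫ x in Ω, inner ℝ (D x) (X x) = - ∫ x in Ω, frob (M x) (jacobian X x)

/-- `u` belongs to `C¹(closure Ω)`: it is continuous on `closure Ω` and differentiable in `Ω`,
and its derivative extends continuously to `closure Ω`. Only the values of `u` on `closure Ω`
matter. -/
def IsC1Closure {d : ℕ} {F : Type} [NormedAddCommGroup F] [NormedSpace ℝ F]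
    (Ω : Set (E d)) (u : E d → F) : Prop :=
  ContinuousOn u (closure Ω) ∧ DifferentiableOn ℝ u Ω ∧
    ∃ G : E d → (E d →L[ℝ] F), ContinuousOn G (closure Ω) ∧ ∀ x ∈ Ω, G x = fderiv ℝ u x

/-! ### The spatial domain -/

/-- In a neighbourhood of `p`, the set `Ω` is, for some unit vector `e`, the set of points below
the graph (over the hyperplane orthogonal to `e`) of a Lipschitz function. The function is written
as a function on `ℝ^d` that is invariant in the direction `e`. -/
def IsLipschitzBoundaryPoint {d : ℕ} (Ω : Set (E d)) (p : E d) : Prop :=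
  ∃ (e : E d) (g : E d → ℝ) (K : NNReal) (r : ℝ),
    ‖e‖ = 1 ∧ LipschitzWith K g ∧ (∀ (x : E d) (s : ℝ), g (x + s • e) = g x) ∧ 0 < r ∧
      ∀ x ∈ Metric.ball p r, x ∈ Ω ↔ inner ℝ x e < g x

/-- The admissible domains: bounded open sets whose boundary is locally a Lipschitz graph, with the
possible exception of a closed set of vanishing `(d-1)`-dimensional Hausdorff measure (the vertices
and edges of a polyhedral domain, for instance). Bounded Lipschitz domains and polyhedral domains
are of this kind. -/
structure IsAdmissibleDomain {d : ℕ} (Ω : Set (E d)) : Prop where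
  isOpen : IsOpen Ω
  isBounded : Bornology.IsBounded Ω
  regular : ∃ Z : Set (E d), IsClosed Z ∧ Measure.hausdorffMeasure ((d : ℝ) - 1) Z = 0 ∧
    ∀ p ∈ frontier Ω \ Z, IsLipschitzBoundaryPoint Ω p

/-- `n` is the outward unit normal of `Ω` at `x`: seen from `x`, the set `Ω` is asymptotically the
half-space of the directions that have a negative component along `n`. -/
def IsOutwardNormal {d : ℕ} (Ω : Set (E d)) (x n : E d) : Prop :=
  ‖n‖ = 1 ∧ ∀ ε > 0, ∃ δ > 0, ∀ y ∈ Metric.ball x δ,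
    (inner ℝ (y - x) n < -(ε * ‖y - x‖) → y ∈ Ω) ∧
    (ε * ‖y - x‖ < inner ℝ (y - x) n → y ∉ Ω)

/-! ### The time discretization -/

/-- The six unknowns at one time: density `ρ`, velocity `v`, phase field `φ`, generalized chemical
potential `μ`, auxiliary variable `τ`, and auxiliary variable `σ` (the gradient of `φ`). -/
structure Fields (d : ℕ) where
  ρ : E d → ℝ
  v : E d → E d
  φ : E d → ℝ
  μ : E d → ℝ
  τ : E d → ℝ
  σ : E d → E d

/-- The arithmetic mean of two iterates; `mid (U n) (U (n+1))` is the value at level `n + 1/2`. -/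
def Fields.mid {d : ℕ} (U V : Fields d) : Fields d where
  ρ := fun x => (V.ρ x + U.ρ x) / 2
  v := fun x => (1 / 2 : ℝ) • (V.v x + U.v x)
  φ := fun x => (V.φ x + U.φ x) / 2
  μ := fun x => (V.μ x + U.μ x) / 2
  τ := fun x => (V.τ x + U.τ x) / 2
  σ := fun x => (1 / 2 : ℝ) • (V.σ x + U.σ x)

/-- The iterates are of class `C¹(closure Ω)` and satisfy the boundary conditions `v = 0` and
`σ · n = 0` on the boundary of `Ω` (the latter wherever the outward normal exists), and the density
is positive. -/
structure Fields.IsAdmissible {d : ℕ} (Ω : Set (E d)) (U : Fields d) : Prop where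
  c1_ρ : IsC1Closure Ω U.ρ
  c1_v : IsC1Closure Ω U.v
  c1_φ : IsC1Closure Ω U.φ
  c1_μ : IsC1Closure Ω U.μ
  c1_τ : IsC1Closure Ω U.τ
  c1_σ : IsC1Closure Ω U.σ
  ρ_pos : ∀ x ∈ Ω, 0 < U.ρ x
  v_boundary : ∀ x ∈ frontier Ω, U.v x = 0
  σ_boundary : ∀ x ∈ frontier Ω, ∀ n, IsOutwardNormal Ω x n → inner ℝ (U.σ x) n = 0

/-- The equations of one time step of length `Δt`, from the iterate `U` to the iterate `V`, with
`W = mid U V`. Here `f ρ φ` is the mixture free energy, `S φ (∇v)` the viscous stress, `γ` the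
capillarity constant and `η` the mobility. The divergence of the stress involves second
derivatives of `v`, which is only `C¹`; it is the weak divergence. Each of the two difference
quotients of `ρ f(ρ, φ)` is prescribed at the points where its denominator does not vanish; nothing
is required at the other points, so that every convention for the quotient there is covered. -/
structure IsTimeStep {d : ℕ} (Ω : Set (E d)) (f : ℝ → ℝ → ℝ)
    (S : ℝ → Matrix (Fin d) (Fin d) ℝ → Matrix (Fin d) (Fin d) ℝ) (γ η Δt : ℝ)
    (U V W : Fields d) : Prop where
  mass : ∀ x ∈ Ω,
    0 = (V.ρ x - U.ρ x) / Δt + divergence (fun y => W.ρ y • W.v y) x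
  momentum : ∃ divS : E d → E d,
    IsWeakTensorDivergence Ω (fun y => S (W.φ y) (jacobian W.v y)) divS ∧
    ∀ᵐ x ∂(volume.restrict Ω),
      0 = W.ρ x • ((1 / Δt) • (V.v x - U.v x))
        + tensorDivergence (fun y => W.ρ y • tensor (W.v y) (W.v y)) x
        - divergence (fun y => W.ρ y • W.v y) x • W.v x
        - (1 / 2 * W.ρ x) • gradient (fun y => ‖W.v y‖ ^ 2) x
        + W.ρ x • gradient W.τ x
        - W.μ x • gradient W.φ x
        - divS x
  phase : ∀ x ∈ Ω,
    0 = (V.φ x - U.φ x) / Δt + inner ℝ (gradient W.φ x) (W.v x) + η * (W.μ x / W.ρ x)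
  potential : ∀ x ∈ Ω, V.φ x ≠ U.φ x →
    0 = W.μ x
      - (V.ρ x * f (V.ρ x) (V.φ x) - V.ρ x * f (V.ρ x) (U.φ x)
          + U.ρ x * f (U.ρ x) (V.φ x) - U.ρ x * f (U.ρ x) (U.φ x))
        / (2 * (V.φ x - U.φ x))
      + γ * divergence W.σ x
  auxiliary : ∀ x ∈ Ω, V.ρ x ≠ U.ρ x →
    0 = W.τ x
      - (V.ρ x * f (V.ρ x) (V.φ x) - U.ρ x * f (U.ρ x) (V.φ x)
          + V.ρ x * f (V.ρ x) (U.φ x) - U.ρ x * f (U.ρ x) (U.φ x))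
        / (2 * (V.ρ x - U.ρ x))
      - 1 / 4 * (‖V.v x‖ ^ 2 + ‖U.v x‖ ^ 2)
  gradient_eq : ∀ x ∈ Ω, 0 = V.σ x - gradient V.φ x

/-- `U 0, …, U N` are the iterates of a time-discrete solution for the time levels
`0 = t 0 < t 1 < … < t N`. The initial value of `σ` is the gradient of the initial phase field. -/
structure IsTimeDiscreteSolution {d : ℕ} (Ω : Set (E d)) (f : ℝ → ℝ → ℝ)
    (S : ℝ → Matrix (Fin d) (Fin d) ℝ → Matrix (Fin d) (Fin d) ℝ) (γ η : ℝ)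
    (N : ℕ) (t : ℕ → ℝ) (U : ℕ → Fields d) : Prop where
  time_zero : t 0 = 0
  time_lt : ∀ n < N, t n < t (n + 1)
  admissible : ∀ n ≤ N, (U n).IsAdmissible Ω
  initial_σ : ∀ x ∈ Ω, (U 0).σ x = gradient (U 0).φ x
  step : ∀ n < N,
    IsTimeStep Ω f S γ η (t (n + 1) - t n) (U n) (U (n + 1)) ((U n).mid (U (n + 1)))

/-- The energy density `ρ f(ρ, φ) + ½ ρ |v|² + (γ/2) |σ|²`. -/
def energyDensity {d : ℕ} (f : ℝ → ℝ → ℝ) (γ : ℝ) (U : Fields d) (x : E d) : ℝ :=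
  U.ρ x * f (U.ρ x) (U.φ x) + 1 / 2 * U.ρ x * ‖U.v x‖ ^ 2 + γ / 2 * ‖U.σ x‖ ^ 2

/-- The dissipation density `S(φ, ∇v) : ∇v + η |μ|² / ρ`. -/
def dissipationDensity {d : ℕ}
    (S : ℝ → Matrix (Fin d) (Fin d) ℝ → Matrix (Fin d) (Fin d) ℝ) (η : ℝ)
    (U : Fields d) (x : E d) : ℝ :=
  frob (S (U.φ x) (jacobian U.v x)) (jacobian U.v x) + η * (|U.μ x| ^ 2 / U.ρ x)

end

end NSAC

/-!
The potentials `μ`, `τ` and the auxiliary equation for `σ` are discrete chain rules: multiplied by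
the increments of `φ` and `ρ` they reproduce exactly the increment of `ρ f(ρ, φ)`, of the kinetic
energy and of the gradient energy. Testing mass, momentum and phase equation with `τ`, `v` and `μ`
at the midpoint therefore gives the energy increment as minus the dissipation plus the divergences
of fields that are tangential at the boundary.

The divergence of a tangential field `X` of class `C¹` up to the boundary integrates to zero.
Near a Lipschitz boundary point one multiplies `X` by a cutoff of the depth below the graph at scale
`1 / m`: its gradient is of order `m` on a slab of volume `O(1 / m)`, where the component of `X`
that it sees tends to zero almost everywhere by tangentiality, since a Lipschitz graph has a normal
almost everywhere. The remaining boundary points have zero `W^{1,1}` capacity, so they can be cut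
off at no cost.

The weak divergence of the stress may be tested with `v`, which vanishes on the boundary: truncating
the values of `v` near `0` makes its support compact, and the gradient survives the limit because
`∇v = 0` almost everywhere on `{v = 0}`.
-/

namespace NSAC

open Set Filter Topology

/-- The function `u` agrees on `Ω` with a function that is continuous on `closure Ω`. For bounded
`Ω`, such functions are bounded and integrable, and they are stable under pointwise operations. -/
def ExtendsToClosure {X F : Type*} [TopologicalSpace X] [TopologicalSpace F]
    (Ω : Set X) (u : X → F) : Prop :=
  ∃ g : X → F, ContinuousOn g (closure Ω) ∧ EqOn u g Ω

namespace ExtendsToClosure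

section Topological

variable {X F G H : Type*} [TopologicalSpace X] [TopologicalSpace F] [TopologicalSpace G]
  [TopologicalSpace H] {Ω : Set X}

lemma of_continuousOn {u : X → F} (hu : ContinuousOn u (closure Ω)) : ExtendsToClosure Ω u :=
  ⟨u, hu, fun _ _ => rfl⟩

lemma const (c : F) : ExtendsToClosure Ω (fun _ => c) := of_continuousOn continuousOn_const

lemma congr {u v : X → F} (hu : ExtendsToClosure Ω u) (h : EqOn v u Ω) :
    ExtendsToClosure Ω v := by
  obtain ⟨g, hg, hug⟩ := hu
  exact ⟨g, hg, h.trans hug⟩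

lemma continuousOn {u : X → F} (hu : ExtendsToClosure Ω u) : ContinuousOn u Ω := by
  obtain ⟨g, hg, hug⟩ := hu
  exact (hg.mono subset_closure).congr hug

lemma comp {u : X → F} {Φ : F → G} (hΦ : Continuous Φ) (hu : ExtendsToClosure Ω u) :
    ExtendsToClosure Ω (fun x => Φ (u x)) := by
  obtain ⟨g, hg, hug⟩ := hu
  exact ⟨Φ ∘ g, hΦ.comp_continuousOn hg, fun x hx => congrArg Φ (hug hx)⟩

lemma prodMk {u : X → F} {v : X → G} (hu : ExtendsToClosure Ω u) (hv : ExtendsToClosure Ω v) :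
    ExtendsToClosure Ω (fun x => (u x, v x)) := by
  obtain ⟨g, hg, hug⟩ := hu
  obtain ⟨k, hk, hvk⟩ := hv
  exact ⟨fun x => (g x, k x), hg.prodMk hk, fun x hx => Prod.ext (hug hx) (hvk hx)⟩

lemma comp₂ {u : X → F} {v : X → G} {Φ : F × G → H} (hΦ : Continuous Φ)
    (hu : ExtendsToClosure Ω u) (hv : ExtendsToClosure Ω v) :
    ExtendsToClosure Ω (fun x => Φ (u x, v x)) :=
  (hu.prodMk hv).comp hΦ

lemma pi {ι : Type*} {u : X → ι → F} (hu : ∀ i, ExtendsToClosure Ω (fun x => u x i)) :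
    ExtendsToClosure Ω u := by
  choose g hg hug using hu
  exact ⟨fun x i => g i x, continuousOn_pi.2 hg, fun x hx => funext fun i => hug i hx⟩

lemma sum {ι : Type*} [AddCommMonoid F] [ContinuousAdd F] (s : Finset ι) {u : ι → X → F}
    (hu : ∀ i, ExtendsToClosure Ω (u i)) : ExtendsToClosure Ω (fun x => ∑ i ∈ s, u i x) :=
  (pi hu (u := fun x i => u i x)).comp (continuous_finsetSum s fun i _ => continuous_apply i)

end Topological

section Normed

variable {X F G : Type*} [TopologicalSpace X] [NormedAddCommGroup F] [NormedAddCommGroup G]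
  {Ω : Set X}

lemma add {u v : X → F} (hu : ExtendsToClosure Ω u) (hv : ExtendsToClosure Ω v) :
    ExtendsToClosure Ω (fun x => u x + v x) := hu.comp₂ continuous_add hv

lemma sub {u v : X → F} (hu : ExtendsToClosure Ω u) (hv : ExtendsToClosure Ω v) :
    ExtendsToClosure Ω (fun x => u x - v x) := hu.comp₂ continuous_sub hv

lemma norm_sq {u : X → F} (hu : ExtendsToClosure Ω u) :
    ExtendsToClosure Ω (fun x => ‖u x‖ ^ 2) := hu.comp (continuous_norm.pow 2)

variable [NormedSpace ℝ F] [NormedSpace ℝ G]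

lemma smul {u : X → ℝ} {v : X → F} (hu : ExtendsToClosure Ω u) (hv : ExtendsToClosure Ω v) :
    ExtendsToClosure Ω (fun x => u x • v x) := hu.comp₂ continuous_smul hv

lemma mul {u v : X → ℝ} (hu : ExtendsToClosure Ω u) (hv : ExtendsToClosure Ω v) :
    ExtendsToClosure Ω (fun x => u x * v x) := hu.comp₂ continuous_mul hv

lemma const_smul {u : X → F} (c : ℝ) (hu : ExtendsToClosure Ω u) :
    ExtendsToClosure Ω (fun x => c • u x) := (const c).smul hu

lemma clm_apply {A : X → F →L[ℝ] G} {v : X → F} (hA : ExtendsToClosure Ω A)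
    (hv : ExtendsToClosure Ω v) : ExtendsToClosure Ω (fun x => A x (v x)) :=
  hA.comp₂ (Φ := fun p : (F →L[ℝ] G) × F => p.1 p.2) isBoundedBilinearMap_apply.continuous hv

lemma inner {H : Type*} [NormedAddCommGroup H] [InnerProductSpace ℝ H] {u v : X → H}
    (hu : ExtendsToClosure Ω u) (hv : ExtendsToClosure Ω v) :
    ExtendsToClosure Ω (fun x => inner ℝ (u x) (v x)) := hu.comp₂ continuous_inner hv

end Normed

section Proper

variable {X F : Type*} [PseudoMetricSpace X] [ProperSpace X] [NormedAddCommGroup F]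
  {Ω : Set X} {u : X → F}

lemma exists_bound (hu : ExtendsToClosure Ω u) (hb : Bornology.IsBounded Ω) :
    ∃ C, 0 ≤ C ∧ ∀ x ∈ Ω, ‖u x‖ ≤ C := by
  obtain ⟨g, hg, hug⟩ := hu
  obtain ⟨C, hC⟩ := hb.isCompact_closure.exists_bound_of_continuousOn hg
  exact ⟨max C 0, le_max_right _ _, fun x hx => by
    rw [hug hx]; exact (hC x (subset_closure hx)).trans (le_max_left _ _)⟩

lemma integrableOn [MeasurableSpace X] [BorelSpace X] {μ : Measure X}
    [IsFiniteMeasureOnCompacts μ] (hu : ExtendsToClosure Ω u) (hb : Bornology.IsBounded Ω)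
    (hm : MeasurableSet Ω) : IntegrableOn u Ω μ := by
  obtain ⟨g, hg, hug⟩ := hu
  exact ((hg.integrableOn_compact' hb.isCompact_closure isClosed_closure.measurableSet).mono_set
    subset_closure).congr_fun hug.symm hm

end Proper

end ExtendsToClosure

namespace IsC1Closure

variable {d : ℕ} {Ω : Set (E d)} {F : Type} [NormedAddCommGroup F] [NormedSpace ℝ F]

lemma extendsToClosure {u : E d → F} (hu : IsC1Closure Ω u) : ExtendsToClosure Ω u :=
  .of_continuousOn hu.1

lemma extendsToClosure_fderiv {u : E d → F} (hu : IsC1Closure Ω u) :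
    ExtendsToClosure Ω (fderiv ℝ u) := by
  obtain ⟨-, -, G, hG, hGu⟩ := hu
  exact ⟨G, hG, fun x hx => (hGu x hx).symm⟩

lemma of_hasFDerivAt {u : E d → F} {u' : E d → E d →L[ℝ] F}
    (hc : ContinuousOn u (closure Ω)) (hu : ∀ x ∈ Ω, HasFDerivAt u (u' x) x)
    (hu' : ExtendsToClosure Ω u') : IsC1Closure Ω u := by
  obtain ⟨g, hg, hug⟩ := hu'
  exact ⟨hc, fun x hx => (hu x hx).differentiableAt.differentiableWithinAt,
    g, hg, fun x hx => by rw [(hu x hx).fderiv, hug hx]⟩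

lemma of_contDiff {u : E d → F} (hu : ContDiff ℝ 1 u) : IsC1Closure Ω u :=
  .of_hasFDerivAt hu.continuous.continuousOn
    (fun x _ => (hu.differentiable one_ne_zero x).hasFDerivAt)
    (.of_continuousOn (hu.continuous_fderiv one_ne_zero).continuousOn)

section IsOpen

variable (ho : IsOpen Ω)
include ho

lemma differentiableAt {u : E d → F} (hu : IsC1Closure Ω u) {x : E d} (hx : x ∈ Ω) :
    DifferentiableAt ℝ u x :=
  hu.2.1.differentiableAt (ho.mem_nhds hx)

lemma hasFDerivAt {u : E d → F} (hu : IsC1Closure Ω u) {x : E d} (hx : x ∈ Ω) :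
    HasFDerivAt u (fderiv ℝ u x) x :=
  (hu.differentiableAt ho hx).hasFDerivAt

lemma contDiffOn {u : E d → F} (hu : IsC1Closure Ω u) : ContDiffOn ℝ 1 u Ω := by
  rw [show (1 : WithTop ℕ∞) = 0 + 1 from rfl, contDiffOn_succ_iff_fderiv_of_isOpen ho,
    contDiffOn_zero]
  exact ⟨hu.2.1, by simp, hu.extendsToClosure_fderiv.continuousOn⟩

lemma add {u v : E d → F} (hu : IsC1Closure Ω u) (hv : IsC1Closure Ω v) :
    IsC1Closure Ω (fun x => u x + v x) :=
  .of_hasFDerivAt (hu.1.add hv.1)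
    (fun _ hx => (hu.hasFDerivAt ho hx).add (hv.hasFDerivAt ho hx))
    (hu.extendsToClosure_fderiv.add hv.extendsToClosure_fderiv)

lemma sub {u v : E d → F} (hu : IsC1Closure Ω u) (hv : IsC1Closure Ω v) :
    IsC1Closure Ω (fun x => u x - v x) :=
  .of_hasFDerivAt (hu.1.sub hv.1)
    (fun _ hx => (hu.hasFDerivAt ho hx).sub (hv.hasFDerivAt ho hx))
    (hu.extendsToClosure_fderiv.sub hv.extendsToClosure_fderiv)

lemma const_smul {u : E d → F} (c : ℝ) (hu : IsC1Closure Ω u) :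
    IsC1Closure Ω (fun x => c • u x) :=
  .of_hasFDerivAt (hu.1.const_smul c) (fun _ hx => (hu.hasFDerivAt ho hx).const_smul c)
    (hu.extendsToClosure_fderiv.const_smul c)

lemma smul {u : E d → ℝ} {v : E d → F} (hu : IsC1Closure Ω u) (hv : IsC1Closure Ω v) :
    IsC1Closure Ω (fun x => u x • v x) :=
  .of_hasFDerivAt (hu.1.smul hv.1)
    (fun _ hx => (hu.hasFDerivAt ho hx).smul (hv.hasFDerivAt ho hx))
    ((hu.extendsToClosure.smul hv.extendsToClosure_fderiv).add
      (hu.extendsToClosure_fderiv.comp₂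
        (Φ := fun p : (E d →L[ℝ] ℝ) × F => p.1.smulRight p.2)
        (ContinuousLinearMap.smulRightL ℝ (E d) F).continuous₂ hv.extendsToClosure))

end IsOpen

end IsC1Closure

section Operators

variable {d : ℕ} {Ω : Set (E d)}

lemma map_eq_sum_coord {F : Type*} [NormedAddCommGroup F] [NormedSpace ℝ F] (A : E d →L[ℝ] F)
    (w : E d) : A w = ∑ j, w j • A (EuclideanSpace.single j 1) := by
  conv_lhs => rw [← (EuclideanSpace.basisFun (Fin d) ℝ).sum_repr w]
  simp

lemma fderiv_coord {u : E d → E d} {x : E d} (hu : DifferentiableAt ℝ u x) (i : Fin d) (w : E d) :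
    fderiv ℝ (fun y => u y i) x w = fderiv ℝ u x w i := by
  have h : HasFDerivAt (fun y => u y i) _ x :=
    (EuclideanSpace.proj (𝕜 := ℝ) i).hasFDerivAt.comp x hu.hasFDerivAt
  rw [h.fderiv]
  rfl

lemma jacobian_apply {u : E d → E d} {x : E d} (hu : DifferentiableAt ℝ u x) (i j : Fin d) :
    jacobian u x i j = fderiv ℝ u x (EuclideanSpace.single j 1) i :=
  fderiv_coord hu i _

lemma divergence_eq {u : E d → E d} {x : E d} (hu : DifferentiableAt ℝ u x) :
    divergence u x = ∑ j, fderiv ℝ u x (EuclideanSpace.single j 1) j :=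
  Finset.sum_congr rfl fun j _ => fderiv_coord hu j _

lemma divergence_congr {u v : E d → E d} {x : E d} (h : u =ᶠ[𝓝 x] v) :
    divergence u x = divergence v x :=
  Finset.sum_congr rfl fun j _ =>
    DFunLike.congr_fun (h.fun_comp fun w : E d => w j).fderiv_eq _

lemma divergence_sum {ι : Type*} (s : Finset ι) {u : ι → E d → E d} {x : E d}
    (hu : ∀ i ∈ s, DifferentiableAt ℝ (u i) x) :
    divergence (fun y => ∑ i ∈ s, u i y) x = ∑ i ∈ s, divergence (u i) x := by
  rw [divergence_eq (.fun_sum hu), fderiv_fun_sum hu, Finset.sum_congr rfl fun i hi =>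
    divergence_eq (hu i hi), Finset.sum_comm]
  simp

lemma divergence_smul {a : E d → ℝ} {u : E d → E d} {x : E d} (ha : DifferentiableAt ℝ a x)
    (hu : DifferentiableAt ℝ u x) :
    divergence (fun y => a y • u y) x = fderiv ℝ a x (u x) + a x * divergence u x := by
  rw [divergence_eq (ha.fun_smul hu), divergence_eq hu, fderiv_fun_smul ha hu,
    map_eq_sum_coord (fderiv ℝ a x) (u x)]
  simp [Finset.sum_add_distrib, Finset.mul_sum, mul_comm, add_comm]

lemma inner_gradient {a : E d → ℝ} (x w : E d) :
    inner ℝ (gradient a x) w = fderiv ℝ a x w := by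
  simp [gradient]

lemma ExtendsToClosure.frob {A B : E d → Matrix (Fin d) (Fin d) ℝ} (hA : ExtendsToClosure Ω A)
    (hB : ExtendsToClosure Ω B) : ExtendsToClosure Ω (fun x => NSAC.frob (A x) (B x)) :=
  hA.comp₂ (Φ := fun p => NSAC.frob p.1 p.2)
    (continuous_finsetSum _ fun i _ => continuous_finsetSum _ fun j _ =>
      (continuous_fst.matrix_elem i j).mul (continuous_snd.matrix_elem i j)) hB

namespace IsC1Closure

lemma extendsToClosure_gradient {a : E d → ℝ} (ha : IsC1Closure Ω a) :
    ExtendsToClosure Ω (gradient a) :=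
  ha.extendsToClosure_fderiv.comp
    (Φ := fun A : E d →L[ℝ] ℝ => (InnerProductSpace.toDual ℝ (E d)).symm A)
    (InnerProductSpace.toDual ℝ (E d)).symm.continuous

lemma extendsToClosure_jacobian {u : E d → E d} (ho : IsOpen Ω) (hu : IsC1Closure Ω u) :
    ExtendsToClosure Ω (jacobian u) :=
  .pi (F := Fin d → ℝ) fun i => .pi fun j =>
    ((hu.extendsToClosure_fderiv.clm_apply (.const (EuclideanSpace.single j 1))).comp
      (EuclideanSpace.proj (𝕜 := ℝ) i).continuous).congr
      fun _ hx => jacobian_apply (hu.differentiableAt ho hx) i j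

lemma extendsToClosure_divergence {u : E d → E d} (ho : IsOpen Ω) (hu : IsC1Closure Ω u) :
    ExtendsToClosure Ω (divergence u) :=
  .sum Finset.univ fun j => (hu.extendsToClosure_jacobian ho).comp
    (Φ := fun A : Matrix (Fin d) (Fin d) ℝ => A j j) (continuous_id.matrix_elem j j)

end IsC1Closure

end Operators

section LipschitzFields

variable {d : ℕ} {Ω : Set (E d)}

lemma divergence_eq_zero_of_notMem_tsupport {Y : E d → E d} {x : E d} (hx : x ∉ tsupport Y) :
    divergence Y x = 0 := by
  rw [divergence_congr (notMem_tsupport_iff_eventuallyEq.1 hx),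
    divergence_eq (u := 0) (differentiableAt_const 0)]
  simp

lemma integrable_fderiv_apply_of_lipschitzWith {V : Type*} [NormedAddCommGroup V]
    [NormedSpace ℝ V] [MeasurableSpace V] [BorelSpace V] [SecondCountableTopology V]
    {μ : Measure V} [IsFiniteMeasureOnCompacts μ] {C : NNReal} {g : V → ℝ}
    (hg : LipschitzWith C g) (hc : HasCompactSupport g) (w : V) :
    Integrable (fun x => fderiv ℝ g x w) μ := by
  rw [← integrableOn_iff_integrable_of_support_subset (s := tsupport g)]
  · refine Measure.integrableOn_of_bounded (M := C * ‖w‖) hc.isCompact.measure_lt_top.ne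
      (measurable_fderiv_apply_const ℝ g w).aestronglyMeasurable (.of_forall fun x => ?_)
    exact (fderiv ℝ g x).le_of_opNorm_le (norm_fderiv_le_of_lipschitz ℝ hg) w
  · intro x hx
    by_contra hxs
    exact hx (by simp [fderiv_of_notMem_tsupport (𝕜 := ℝ) hxs])

lemma integral_fderiv_apply_eq_zero_of_lipschitzWith {V : Type*} [NormedAddCommGroup V]
    [NormedSpace ℝ V] [FiniteDimensional ℝ V] [MeasurableSpace V] [BorelSpace V]
    {μ : Measure V} [μ.IsAddHaarMeasure] {C : NNReal} {g : V → ℝ}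
    (hg : LipschitzWith C g) (hc : HasCompactSupport g) (w : V) :
    ∫ x, fderiv ℝ g x w ∂μ = 0 := by
  have hparts := (LipschitzWith.const (1 : ℝ)).integral_lineDeriv_mul_eq (μ := μ) hg hc (-w)
  calc ∫ x, fderiv ℝ g x w ∂μ = ∫ x, lineDeriv ℝ g x w ∂μ := integral_congr_ae <| by
        filter_upwards [hg.ae_differentiableAt] with x hx using hx.lineDeriv_eq_fderiv.symm
    _ = 0 := by simpa [lineDeriv] using hparts.symm

lemma integral_divergence_eq_zero_of_lipschitzWith {C : NNReal} {Y : E d → E d}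
    (hY : LipschitzWith C Y) (hc : HasCompactSupport Y) : ∫ x, divergence Y x = 0 := by
  have hYj : ∀ j, LipschitzWith _ fun x => Y x j := fun j =>
    (EuclideanSpace.proj (𝕜 := ℝ) j).lipschitz.comp hY
  have hcj : ∀ j, HasCompactSupport fun x => Y x j := fun j =>
    hc.comp_left (g := fun w : E d => w j) rfl
  simp only [divergence, pderiv]
  rw [integral_finsetSum _ fun j _ => integrable_fderiv_apply_of_lipschitzWith (hYj j) (hcj j) _]
  exact Finset.sum_eq_zero fun j _ =>
    integral_fderiv_apply_eq_zero_of_lipschitzWith (hYj j) (hcj j) _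

lemma lipschitzWith_smul_of_bounded {α V : Type*} [PseudoMetricSpace α] [NormedAddCommGroup V]
    [NormedSpace ℝ V] {a : α → ℝ} {b : α → V} {Ca Cb A B : NNReal} (ha : LipschitzWith Ca a)
    (hb : LipschitzWith Cb b) (hA : ∀ x, ‖a x‖ ≤ A) (hB : ∀ x, ‖b x‖ ≤ B) :
    LipschitzWith (A * Cb + Ca * B) fun x => a x • b x := by
  refine LipschitzWith.of_dist_le_mul fun x y => ?_
  have hax := ha.dist_le_mul x y
  have hbx := hb.dist_le_mul x y
  rw [dist_eq_norm] at hax hbx ⊢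
  calc ‖a x • b x - a y • b y‖ = ‖a x • (b x - b y) + (a x - a y) • b y‖ := by
        congr 1; module
    _ ≤ ‖a x‖ * ‖b x - b y‖ + ‖a x - a y‖ * ‖b y‖ := by
        simpa only [norm_smul] using norm_add_le (a x • (b x - b y)) ((a x - a y) • b y)
    _ ≤ A * (Cb * dist x y) + Ca * dist x y * B := by
        gcongr
        exacts [hA x, hB y]
    _ = _ := by push_cast; ring

lemma exists_contDiff_eq_one_on_compact {V : Type*} [NormedAddCommGroup V] [NormedSpace ℝ V]
    [FiniteDimensional ℝ V] {U K : Set V} (hU : IsOpen U) (hK : IsCompact K) (hKU : K ⊆ U) :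
    ∃ κ : V → ℝ, ContDiff ℝ ∞ κ ∧ HasCompactSupport κ ∧ tsupport κ ⊆ U ∧ ∀ x ∈ K, κ x = 1 := by
  obtain ⟨L, hL, hKL, hLU⟩ := exists_compact_between hK hU hKU
  obtain ⟨κ, hκ, -, hsupp, hone⟩ := exists_contMDiff_support_eq_eq_one_iff
    (I := modelWithCornersSelf ℝ V) isOpen_interior hK.isClosed hKL
  have hts : tsupport κ ⊆ L := by
    rw [tsupport, hsupp]
    exact closure_minimal interior_subset hL.isClosed
  exact ⟨κ, hκ.contDiff, hL.of_isClosed_subset (isClosed_tsupport _) hts,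
    hts.trans hLU, fun x hx => (hone x).1 hx⟩

lemma contDiff_of_contDiffOn_of_tsupport_subset {V F : Type*} [NormedAddCommGroup V]
    [NormedSpace ℝ V] [NormedAddCommGroup F] [NormedSpace ℝ F] {n : WithTop ℕ∞} {U : Set V}
    (hU : IsOpen U) {u : V → F} (hu : ContDiffOn ℝ n u U) (hs : tsupport u ⊆ U) :
    ContDiff ℝ n u :=
  (contMDiff_of_tsupport fun _ hx => (hu.contDiffAt (hU.mem_nhds (hs hx))).contMDiffAt).contDiff

lemma integral_divergence_smul_eq_zero_of_hasCompactSupport (ho : IsOpen Ω) {X : E d → E d}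
    (hX : ContDiffOn ℝ 1 X Ω) {θ : E d → ℝ} {C B : NNReal} (hθ : LipschitzWith C θ)
    (hB : ∀ x, ‖θ x‖ ≤ B) (hc : HasCompactSupport fun x => θ x • X x)
    (hs : tsupport (fun x => θ x • X x) ⊆ Ω) :
    ∫ x in Ω, divergence (fun y => θ y • X y) x = 0 := by
  obtain ⟨κ, hκ, hκc, hκs, hκ1⟩ := exists_contDiff_eq_one_on_compact ho hc.isCompact hs
  have hκX : ContDiff ℝ 1 fun x => κ x • X x :=
    contDiff_of_contDiffOn_of_tsupport_subset ho
      ((hκ.of_le (by exact_mod_cast le_top)).contDiffOn.smul hX)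
      ((tsupport_smul_subset_left κ X).trans hκs)
  have hκXc : HasCompactSupport fun x => κ x • X x := hκc.smul_right
  obtain ⟨D, hD⟩ := hκX.lipschitzWith_of_hasCompactSupport hκXc one_ne_zero
  obtain ⟨A, hA⟩ := hκX.continuous.bounded_above_of_compact_support hκXc
  have hcutoff : (fun x => θ x • X x) = fun x => θ x • κ x • X x := by
    funext x
    by_cases hx : x ∈ tsupport fun x => θ x • X x
    · rw [hκ1 x hx, one_smul]
    · rw [smul_comm, image_eq_zero_of_notMem_tsupport (f := fun y => θ y • X y) hx,
        smul_zero]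
  have hLip : LipschitzWith _ fun x => θ x • X x := hcutoff ▸
    lipschitzWith_smul_of_bounded hθ hD hB fun x => (hA x).trans (Real.le_coe_toNNReal A)
  rw [setIntegral_eq_integral_of_forall_compl_eq_zero fun x hx =>
    divergence_eq_zero_of_notMem_tsupport fun hxs => hx (hs hxs)]
  exact integral_divergence_eq_zero_of_lipschitzWith hLip hc

end LipschitzFields

section SmoothTransition

open Real

lemma deriv_smoothTransition_eq_zero {s : ℝ} (hs : s ∉ Icc (0 : ℝ) 1) :
    deriv smoothTransition s = 0 := by
  have hconst : smoothTransition =ᶠ[𝓝 s] fun _ => smoothTransition s := by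
    rcases lt_or_ge s 0 with hneg | hnonneg
    · filter_upwards [Iio_mem_nhds hneg] with y hy
      rw [smoothTransition.zero_of_nonpos (le_of_lt hy), smoothTransition.zero_of_nonpos hneg.le]
    · have hone : 1 < s := not_le.1 fun h => hs ⟨hnonneg, h⟩
      filter_upwards [Ioi_mem_nhds hone] with y hy
      rw [smoothTransition.one_of_one_le (le_of_lt hy), smoothTransition.one_of_one_le hone.le]
  rw [hconst.deriv_eq, deriv_const]

lemma exists_lipschitzWith_smoothTransition : ∃ M : NNReal, LipschitzWith M smoothTransition := by
  have hsmooth : ContDiff ℝ 1 smoothTransition := smoothTransition.contDiff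
  have hsupp : HasCompactSupport (deriv smoothTransition) :=
    .intro isCompact_Icc fun _ => deriv_smoothTransition_eq_zero
  obtain ⟨M, hM⟩ := (hsmooth.continuous_deriv le_rfl).bounded_above_of_compact_support hsupp
  exact ⟨M.toNNReal, lipschitzWith_of_nnnorm_deriv_le (hsmooth.differentiable one_ne_zero)
    fun s => NNReal.coe_le_coe.1 ((hM s).trans (le_coe_toNNReal M))⟩

end SmoothTransition

section Depth

/-- In a graph chart of the boundary of a domain, the signed depth `h` below the graph: `e` is the
upward unit vector, along which `h` decreases at unit rate, and the domain is `{x | 0 < h x}`. -/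
structure IsDepthFunction {V : Type*} [NormedAddCommGroup V] [NormedSpace ℝ V] (e : V) (L : NNReal)
    (h : V → ℝ) : Prop where
  norm_eq_one : ‖e‖ = 1
  lipschitzWith : LipschitzWith L h
  map_add_smul : ∀ (x : V) (s : ℝ), h (x + s • e) = h x - s

lemma IsLipschitzBoundaryPoint.exists_isDepthFunction {d : ℕ} {Ω : Set (E d)} {p : E d}
    (hp : IsLipschitzBoundaryPoint Ω p) :
    ∃ e L h, IsDepthFunction e L h ∧ ∃ r > 0, ∀ x ∈ Metric.ball p r, x ∈ Ω ↔ 0 < h x := by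
  obtain ⟨e, g, K, r, he, hg, hge, hr, hΩ⟩ := hp
  refine ⟨e, K + ‖innerSL ℝ e‖₊, fun x => g x - innerSL ℝ e x,
    ⟨he, hg.sub (innerSL ℝ e).lipschitz, fun x s => ?_⟩, r, hr, fun x hx => ?_⟩
  · simp only [hge, innerSL_apply_apply, inner_add_right, real_inner_smul_right,
      real_inner_self_eq_norm_sq, he]
    ring
  · simp only [hΩ x hx, innerSL_apply_apply, real_inner_comm x e, sub_pos]

namespace IsDepthFunction

variable {V : Type*} [NormedAddCommGroup V] [NormedSpace ℝ V] {e : V} {L : NNReal} {h : V → ℝ}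
  (hh : IsDepthFunction e L h)
include hh

lemma hasFDerivAt_add_smul {A : V →L[ℝ] ℝ} {x : V} (hA : HasFDerivAt h A x) (s : ℝ) :
    HasFDerivAt h A (x + s • e) := by
  have hshift : HasFDerivAt (fun y => h (y + (-s) • e) - s) A (x + s • e) :=
    ((hasFDerivAt_comp_add_right _).2 (by simpa [add_assoc] using hA)).sub_const s
  simpa only [hh.map_add_smul, sub_neg_eq_add, add_sub_cancel_right] using hshift

lemma mem_frontier {Ω : Set V} {q : V} (hΩ : ∀ᶠ y in 𝓝 q, y ∈ Ω ↔ 0 < h y) (hq : h q = 0) :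
    q ∈ frontier Ω := by
  have hline : Tendsto (fun s : ℝ => q + s • e) (𝓝[<] 0) (𝓝 q) := by
    have : Continuous fun s : ℝ => q + s • e := by fun_prop
    simpa using (this.tendsto 0).mono_left nhdsWithin_le_nhds
  refine ⟨mem_closure_of_tendsto hline ?_, fun hint => ?_⟩
  · filter_upwards [hline.eventually hΩ, self_mem_nhdsWithin] with s hs hneg
    rw [hs, hh.map_add_smul, hq]
    simpa using hneg
  · exact hq.not_gt (hΩ.self_of_nhds.1 (interior_subset hint))

/-- The `m` translates of the slab by multiples of `2 / m` along `e` are disjoint. -/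
lemma volume_slab_mul_le [MeasurableSpace V] [BorelSpace V] {μ : Measure V}
    [μ.IsAddRightInvariant] {p : V} {r : ℝ} (hμ : μ (Metric.ball p (r + 2)) ≠ ⊤) {m : ℕ}
    (hm : 0 < m) :
    μ.real {x ∈ Metric.ball p r | h x ∈ Icc (1 / m : ℝ) (2 / m)} * m
      ≤ μ.real (Metric.ball p (r + 2)) := by
  set A := {x ∈ Metric.ball p r | h x ∈ Icc (1 / m : ℝ) (2 / m)}
  have hm' : (0 : ℝ) < m := by exact_mod_cast hm
  have hA : MeasurableSet A :=
    Metric.isOpen_ball.measurableSet.inter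
      (hh.lipschitzWith.continuous.measurable measurableSet_Icc)
  let T : ℕ → Set V := fun k => (fun x => x + (2 * k / m : ℝ) • e) ⁻¹' A
  have hT : ∀ k, μ.real (T k) = μ.real A := fun k => by
    simp only [T, Measure.real, measure_preimage_add_right]
  have hdisj : ∀ k l : ℕ, k < l → Disjoint (T k) (T l) := by
    refine fun k l hkl => Set.disjoint_left.2 ?_
    rintro x ⟨-, -, hk⟩ ⟨-, hl, -⟩
    rw [hh.map_add_smul] at hk hl
    have hkl' : 2 * (k + 1) / (m : ℝ) ≤ 2 * l / m := by
      gcongr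
      exact_mod_cast hkl
    have : 0 < 1 / (m : ℝ) := by positivity
    have : 2 * (k + 1) / (m : ℝ) = 2 * k / m + 2 / m := by ring
    have : 2 / (m : ℝ) = 1 / m + 1 / m := by ring
    linarith
  have hball : ∀ k ∈ Finset.range m, T k ⊆ Metric.ball p (r + 2) := by
    rintro k hk x ⟨hx, -⟩
    have hkm : (k : ℝ) ≤ m := by exact_mod_cast (Finset.mem_range.1 hk).le
    have hshift : dist x (x + (2 * k / m : ℝ) • e) ≤ 2 := by
      rw [dist_self_add_right, norm_smul, hh.norm_eq_one, mul_one,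
        Real.norm_of_nonneg (by positivity), div_le_iff₀ hm']
      linarith
    rw [Metric.mem_ball] at hx ⊢
    linarith [dist_triangle x (x + (2 * k / m : ℝ) • e) p]
  calc μ.real A * m = ∑ k ∈ Finset.range m, μ.real (T k) := by simp [hT, mul_comm]
    _ = μ.real (⋃ k ∈ Finset.range m, T k) := by
        refine (measureReal_biUnion_finset ?_ (fun k _ => measurable_add_const _ hA)
          fun k hk => ne_top_of_le_ne_top hμ (measure_mono (hball k hk))).symm
        exact fun k _ l _ hkl => hkl.lt_or_gt.elim (hdisj k l) fun hlk => (hdisj l k hlk).symm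
    _ ≤ _ := measureReal_mono (iUnion₂_subset hball) hμ

end IsDepthFunction

end Depth

section Tangential

variable {d : ℕ} {Ω : Set (E d)}

/-- The vector field `X` has no normal component on the boundary of `Ω`, wherever the boundary has
an outward normal. -/
def IsTangential (Ω : Set (E d)) (X : E d → E d) : Prop :=
  ∀ x ∈ frontier Ω, ∀ n, IsOutwardNormal Ω x n → inner ℝ (X x) n = 0

lemma IsTangential.smul {X : E d → E d} (hX : IsTangential Ω X) (a : E d → ℝ) :
    IsTangential Ω fun x => a x • X x := fun x hx n hn => by
  rw [real_inner_smul_left, hX x hx n hn, mul_zero]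

lemma isOutwardNormal_of_hasFDerivAt {h : E d → ℝ} {q : E d}
    (hΩ : ∀ᶠ y in 𝓝 q, y ∈ Ω ↔ 0 < h y) (hq : h q = 0) {A : E d →L[ℝ] ℝ}
    (hA : HasFDerivAt h A q) (hA0 : A ≠ 0) :
    IsOutwardNormal Ω q (-(‖A‖⁻¹ • (InnerProductSpace.toDual ℝ (E d)).symm A)) := by
  have hpos : 0 < ‖A‖ := norm_pos_iff.2 hA0
  have hinner : ∀ w, inner ℝ w (-(‖A‖⁻¹ • (InnerProductSpace.toDual ℝ (E d)).symm A))
      = -A w / ‖A‖ := fun w => by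
    rw [inner_neg_right, real_inner_smul_right, real_inner_comm,
      InnerProductSpace.toDual_symm_apply]
    ring
  refine ⟨?_, fun ε hε => ?_⟩
  · rw [norm_neg, norm_smul, norm_inv, norm_norm, LinearIsometryEquiv.norm_map,
      inv_mul_cancel₀ hpos.ne']
  · have hlo := hA.isLittleO.def (c := ε * ‖A‖) (by positivity)
    obtain ⟨δ, hδ, hδb⟩ := Metric.eventually_nhds_iff_ball.1 (hlo.and hΩ)
    refine ⟨δ, hδ, fun y hy => ?_⟩
    obtain ⟨hlin, hyΩ⟩ := hδb y hy
    rw [hq, sub_zero, Real.norm_eq_abs, abs_le] at hlin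
    rw [hinner, hyΩ, div_lt_iff₀ hpos, lt_div_iff₀ hpos, not_lt]
    constructor <;> intro <;> linarith

lemma IsTangential.apply_eq_zero_of_hasFDerivAt {X : E d → E d} (hX : IsTangential Ω X)
    {h : E d → ℝ} {q : E d} (hΩ : ∀ᶠ y in 𝓝 q, y ∈ Ω ↔ 0 < h y) (hq : h q = 0)
    (hqΩ : q ∈ frontier Ω) {A : E d →L[ℝ] ℝ} (hA : HasFDerivAt h A q) : A (X q) = 0 := by
  rcases eq_or_ne A 0 with rfl | hA0
  · rfl
  have hn := hX q hqΩ _ (isOutwardNormal_of_hasFDerivAt hΩ hq hA hA0)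
  rw [inner_neg_right, real_inner_smul_right, real_inner_comm,
    InnerProductSpace.toDual_symm_apply, neg_eq_zero, mul_eq_zero] at hn
  exact hn.resolve_left (inv_ne_zero (norm_ne_zero_iff.2 hA0))

/-- The vertical projection `x + h x • e` of `x` to the boundary has the same normal direction. -/
lemma IsDepthFunction.norm_apply_le_of_isTangential {e : E d} {L : NNReal} {h : E d → ℝ}
    (hh : IsDepthFunction e L h) {X : E d → E d} (hX : IsTangential Ω X) {x : E d}
    (hΩ : ∀ᶠ y in 𝓝 (x + h x • e), y ∈ Ω ↔ 0 < h y) {A : E d →L[ℝ] ℝ}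
    (hA : HasFDerivAt h A x) : ‖A (X x)‖ ≤ L * ‖X x - X (x + h x • e)‖ := by
  have hq : h (x + h x • e) = 0 := by rw [hh.map_add_smul, sub_self]
  have hAq : A (X (x + h x • e)) = 0 :=
    hX.apply_eq_zero_of_hasFDerivAt hΩ hq (hh.mem_frontier hΩ hq) (hh.hasFDerivAt_add_smul hA _)
  rw [← sub_zero (A (X x)), ← hAq, ← map_sub]
  exact A.le_of_opNorm_le (hA.le_of_lipschitz hh.lipschitzWith) _

end Tangential

section DepthCutoff

/-- A cutoff away from the boundary: it vanishes where `h ≤ 1 / m` and equals `1` where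
`2 / m ≤ h`. -/
noncomputable def depthCutoff {V : Type*} (h : V → ℝ) (m : ℕ) (x : V) : ℝ :=
  Real.smoothTransition (m * h x - 1)

section Pointwise

variable {V : Type*} {h : V → ℝ} {m : ℕ} {x : V}

lemma norm_depthCutoff_le_one : ‖depthCutoff h m x‖ ≤ 1 :=
  (Real.norm_of_nonneg (Real.smoothTransition.nonneg _)).trans_le (Real.smoothTransition.le_one _)

lemma depthCutoff_eq_zero (hm : 0 < m) (hx : h x ≤ 1 / m) : depthCutoff h m x = 0 := by
  rw [le_div_iff₀ (by exact_mod_cast hm)] at hx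
  exact Real.smoothTransition.zero_of_nonpos (by linarith)

lemma tendsto_depthCutoff (hx : 0 < h x) : Tendsto (depthCutoff h · x) atTop (𝓝 1) := by
  refine tendsto_const_nhds.congr' ?_
  filter_upwards [eventually_ge_atTop ⌈2 / h x⌉₊] with m hm
  have htwo : 2 ≤ m * h x := (div_le_iff₀ hx).1 (Nat.ceil_le.1 hm)
  exact (Real.smoothTransition.one_of_one_le (by linarith)).symm

lemma lipschitzWith_depthCutoff [PseudoMetricSpace V] {M L : NNReal}
    (hM : LipschitzWith M Real.smoothTransition) (hh : LipschitzWith L h) (m : ℕ) :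
    LipschitzWith (M * (m * L)) (depthCutoff h m) :=
  hM.comp <| LipschitzWith.of_dist_le_mul fun x y => by
    rw [dist_sub_right, Real.dist_eq, ← mul_sub, abs_mul, Nat.abs_cast, ← Real.dist_eq]
    push_cast
    rw [mul_assoc]
    gcongr
    exact hh.dist_le_mul x y

lemma hasFDerivAt_depthCutoff [NormedAddCommGroup V] [NormedSpace ℝ V] {A : V →L[ℝ] ℝ}
    (hA : HasFDerivAt h A x) (m : ℕ) :
    HasFDerivAt (depthCutoff h m)
      (deriv Real.smoothTransition (m * h x - 1) • ((m : ℝ) • A)) x :=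
  ((Real.smoothTransition.contDiff (n := 1)).differentiable one_ne_zero
    _).hasDerivAt.comp_hasFDerivAt x ((hA.const_mul (m : ℝ)).sub_const 1)

lemma norm_fderiv_depthCutoff_apply_le [NormedAddCommGroup V] [NormedSpace ℝ V] {M : NNReal}
    (hM : LipschitzWith M Real.smoothTransition) {A : V →L[ℝ] ℝ} (hA : HasFDerivAt h A x)
    (hm : 0 < m) (w : V) : ‖fderiv ℝ (depthCutoff h m) x w‖
      ≤ {y | h y ∈ Icc (1 / m : ℝ) (2 / m)}.indicator (fun _ => M * m * ‖A w‖) x := by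
  have hm' : (0 : ℝ) < m := by exact_mod_cast hm
  rw [(hasFDerivAt_depthCutoff hA m).fderiv, smul_apply,
    smul_apply, norm_smul, norm_smul, Real.norm_natCast, ← mul_assoc]
  by_cases hx : x ∈ {y | h y ∈ Icc (1 / m : ℝ) (2 / m)}
  · rw [indicator_of_mem hx]
    gcongr
    exact norm_deriv_le_of_lipschitz hM
  · rw [indicator_of_notMem hx, deriv_smoothTransition_eq_zero]
    · simp
    · rintro ⟨h0, h1⟩
      refine hx ⟨?_, ?_⟩
      · rw [div_le_iff₀ hm']; linarith
      · rw [le_div_iff₀ hm']; linarith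

end Pointwise

lemma tendsto_integral_depthCutoff_mul {V : Type*} [TopologicalSpace V] [MeasurableSpace V]
    [OpensMeasurableSpace V] {μ : Measure V} {h q : V → ℝ} (hh : Continuous h)
    (hq : Integrable q μ) (hpos : ∀ᵐ x ∂μ, q x ≠ 0 → 0 < h x) :
    Tendsto (fun m => ∫ x, depthCutoff h m x * q x ∂μ) atTop (𝓝 (∫ x, q x ∂μ)) := by
  refine tendsto_integral_of_dominated_convergence (fun x => ‖q x‖) (fun m => ?_) hq.norm
    (fun m => .of_forall fun x => ?_) ?_
  · exact (Real.smoothTransition.continuous.comp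
      (by fun_prop : Continuous fun x => m * h x - 1)).aestronglyMeasurable.mul
        hq.aestronglyMeasurable
  · rw [norm_mul]
    exact mul_le_of_le_one_left (norm_nonneg _) norm_depthCutoff_le_one
  · filter_upwards [hpos] with x hx
    rcases eq_or_ne (q x) 0 with hqx | hqx
    · simp [hqx]
    · simpa using (tendsto_depthCutoff (hx hqx)).mul_const (q x)

/-- The gradient of the cutoff is of order `m`, but the slab where it is nonzero has volume of
order `1 / m`. -/
lemma IsDepthFunction.norm_integral_fderiv_depthCutoff_le {V : Type*} [NormedAddCommGroup V]
    [NormedSpace ℝ V] [FiniteDimensional ℝ V] [MeasurableSpace V] [BorelSpace V] {μ : Measure V}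
    [μ.IsAddHaarMeasure] {e : V} {L M : NNReal} {h : V → ℝ} (hh : IsDepthFunction e L h)
    (hM : LipschitzWith M Real.smoothTransition) {s : Set V} (hs : MeasurableSet s) {Y : V → V}
    {p : V} {r κ : ℝ} (hκ : 0 ≤ κ) {m : ℕ} (hm : 0 < m)
    (hY : ∀ x ∈ s, Y x ≠ 0 → x ∈ Metric.ball p r)
    (hYκ : ∀ x ∈ s, h x ≤ 2 / m → ∀ A : V →L[ℝ] ℝ, HasFDerivAt h A x → ‖A (Y x)‖ ≤ κ) :
    ‖∫ x in s, fderiv ℝ (depthCutoff h m) x (Y x) ∂μ‖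
      ≤ M * μ.real (Metric.ball p (r + 2)) * κ := by
  set A := {x ∈ Metric.ball p r | h x ∈ Icc (1 / m : ℝ) (2 / m)}
  have hA : MeasurableSet A :=
    Metric.isOpen_ball.measurableSet.inter
      (hh.lipschitzWith.continuous.measurable measurableSet_Icc)
  have hAtop : μ A ≠ ⊤ := ne_top_of_le_ne_top measure_ball_lt_top.ne (measure_mono fun x hx => hx.1)
  have hconst : Integrable (A.indicator fun _ => M * m * κ) μ :=
    (integrable_indicator_iff hA).2 (integrableOn_const hAtop)
  have hbound : ∀ᵐ x ∂(μ.restrict s), ‖fderiv ℝ (depthCutoff h m) x (Y x)‖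
      ≤ A.indicator (fun _ => M * m * κ) x := by
    filter_upwards [ae_restrict_mem hs, ae_restrict_of_ae hh.lipschitzWith.ae_differentiableAt]
      with x hxs hxd
    rcases eq_or_ne (Y x) 0 with hYx | hYx
    · rw [hYx, map_zero, norm_zero]
      exact indicator_nonneg (fun _ _ => by positivity) x
    refine (norm_fderiv_depthCutoff_apply_le hM hxd.hasFDerivAt hm _).trans ?_
    by_cases hx : x ∈ {y | h y ∈ Icc (1 / m : ℝ) (2 / m)}
    · rw [indicator_of_mem (show x ∈ A from ⟨hY x hxs hYx, hx⟩), indicator_of_mem hx]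
      gcongr
      exact hYκ x hxs hx.2 _ hxd.hasFDerivAt
    · rw [indicator_of_notMem hx]
      exact indicator_nonneg (fun _ _ => by positivity) x
  calc ‖∫ x in s, fderiv ℝ (depthCutoff h m) x (Y x) ∂μ‖
      ≤ ∫ x in s, A.indicator (fun _ => M * m * κ) x ∂μ :=
        norm_integral_le_of_norm_le hconst.restrict hbound
    _ ≤ ∫ x, A.indicator (fun _ => M * m * κ) x ∂μ :=
        setIntegral_le_integral hconst
          (.of_forall fun x => indicator_nonneg (fun _ _ => by positivity) x)
    _ = M * κ * (μ.real A * m) := by rw [integral_indicator_const _ hA, smul_eq_mul]; ring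
    _ ≤ M * κ * μ.real (Metric.ball p (r + 2)) := by
        gcongr
        exact hh.volume_slab_mul_le measure_ball_lt_top.ne hm
    _ = _ := by ring

end DepthCutoff

section LocalDivergenceTheorem

variable {d : ℕ} {Ω : Set (E d)}

lemma nonpos_of_forall_pos_le_mul {a D : ℝ} (h : ∀ κ > 0, a ≤ D * κ) : a ≤ 0 := by
  have hlim : Tendsto (fun κ => D * κ) (𝓝[>] 0) (𝓝 (D * 0)) :=
    (continuous_const_mul D).continuousWithinAt
  simpa using ge_of_tendsto hlim (eventually_mem_nhdsWithin.mono h)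

lemma integrableOn_fderiv_apply_of_lipschitzWith (hb : Bornology.IsBounded Ω) (ho : IsOpen Ω)
    {C : NNReal} {θ : E d → ℝ} (hθ : LipschitzWith C θ) {X : E d → E d}
    (hX : ExtendsToClosure Ω X) : IntegrableOn (fun x => fderiv ℝ θ x (X x)) Ω := by
  have hXi := hX.integrableOn (μ := volume) hb ho.measurableSet
  refine (hXi.norm.const_mul (C : ℝ)).mono' ?_ (.of_forall fun x => ?_)
  · exact (ContinuousLinearMap.id ℝ (E d →L[ℝ] ℝ)).aestronglyMeasurable_comp₂
      (measurable_fderiv ℝ θ).aestronglyMeasurable hXi.aestronglyMeasurable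
  · exact (fderiv ℝ θ x).le_of_opNorm_le (norm_fderiv_le_of_lipschitz ℝ hθ) _

section Chart

variable {e p : E d} {L M : NNReal} {h : E d → ℝ} {r : ℝ} {X : E d → E d}

lemma IsDepthFunction.integral_depthCutoff_mul_divergence (hh : IsDepthFunction e L h)
    (hM : LipschitzWith M Real.smoothTransition) (ho : IsOpen Ω) (hb : Bornology.IsBounded Ω)
    (hΩ : ∀ x ∈ Metric.ball p r, x ∈ Ω ↔ 0 < h x) (hX : IsC1Closure Ω X)
    (hXs : tsupport X ⊆ Metric.ball p r) {m : ℕ} (hm : 0 < m) :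
    ∫ x in Ω, depthCutoff h m x * divergence X x
      = -∫ x in Ω, fderiv ℝ (depthCutoff h m) x (X x) := by
  have hcut := lipschitzWith_depthCutoff hM hh.lipschitzWith m
  have hsupp : tsupport (fun x => depthCutoff h m x • X x)
      ⊆ tsupport X ∩ {x | (1 : ℝ) / m ≤ h x} := by
    refine closure_minimal (fun x hx => ?_)
      ((isClosed_tsupport X).inter (isClosed_le continuous_const hh.lipschitzWith.continuous))
    obtain ⟨hcutx, hXx⟩ := smul_ne_zero_iff.1 hx
    exact ⟨subset_tsupport _ hXx, not_lt.1 fun hlt => hcutx (depthCutoff_eq_zero hm hlt.le)⟩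
  have hzero : ∫ x in Ω, divergence (fun y => depthCutoff h m y • X y) x = 0 := by
    refine integral_divergence_smul_eq_zero_of_hasCompactSupport ho (hX.contDiffOn ho) hcut
      (B := 1) (fun _ => norm_depthCutoff_le_one) ?_ fun x hx => ?_
    · exact Metric.isCompact_of_isClosed_isBounded (isClosed_tsupport _)
        (Metric.isBounded_ball.subset fun x hx => hXs (hsupp hx).1)
    · exact (hΩ x (hXs (hsupp hx).1)).2 (lt_of_lt_of_le (by positivity) (hsupp hx).2)
  have hleibniz : ∀ᵐ x ∂(volume.restrict Ω), divergence (fun y => depthCutoff h m y • X y) x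
      = fderiv ℝ (depthCutoff h m) x (X x) + depthCutoff h m x * divergence X x := by
    filter_upwards [ae_restrict_mem ho.measurableSet, ae_restrict_of_ae hcut.ae_differentiableAt]
      with x hx hxd using divergence_smul hxd (hX.differentiableAt ho hx)
  rw [integral_congr_ae hleibniz, integral_add] at hzero
  · linarith
  · exact integrableOn_fderiv_apply_of_lipschitzWith hb ho hcut hX.extendsToClosure
  · exact ((ExtendsToClosure.of_continuousOn hcut.continuous.continuousOn).mul
      (hX.extendsToClosure_divergence ho)).integrableOn hb ho.measurableSet

lemma IsDepthFunction.eventually_norm_apply_le (hh : IsDepthFunction e L h)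
    (hb : Bornology.IsBounded Ω) (hr : 0 < r)
    (hΩ : ∀ x ∈ Metric.ball p r, x ∈ Ω ↔ 0 < h x) (hX : ContinuousOn X (closure Ω))
    (hXn : IsTangential Ω X) (hXs : tsupport X ⊆ Metric.ball p (r / 2)) {κ : ℝ} (hκ : 0 < κ) :
    ∀ᶠ m : ℕ in atTop, ∀ x ∈ Ω, h x ≤ 2 / m → ∀ A : E d →L[ℝ] ℝ, HasFDerivAt h A x →
      ‖A (X x)‖ ≤ L * κ := by
  obtain ⟨δ, hδ, hδX⟩ := Metric.uniformContinuousOn_iff.1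
    (hb.isCompact_closure.uniformContinuousOn_of_continuous hX) κ hκ
  have hsmall : ∀ᶠ m : ℕ in atTop, (2 : ℝ) / m < min δ (r / 2) :=
    (tendsto_const_div_atTop_nhds_zero_nat 2).eventually_lt_const (by positivity)
  filter_upwards [hsmall] with m hm x hx hxm A hA
  rcases eq_or_ne (X x) 0 with hXx | hXx
  · simp only [hXx, map_zero, norm_zero]
    positivity
  have hxp : x ∈ Metric.ball p (r / 2) := hXs (subset_tsupport _ hXx)
  have hpos : 0 < h x := (hΩ x (Metric.ball_subset_ball (half_le_self hr.le) hxp)).1 hx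
  have hdist : dist x (x + h x • e) = h x := by
    rw [dist_self_add_right, norm_smul, hh.norm_eq_one, mul_one, Real.norm_of_nonneg hpos.le]
  have hq : x + h x • e ∈ Metric.ball p r := by
    rw [Metric.mem_ball] at hxp ⊢
    linarith [dist_triangle_left (x + h x • e) p x, min_le_right δ (r / 2)]
  have hΩq : ∀ᶠ y in 𝓝 (x + h x • e), y ∈ Ω ↔ 0 < h y :=
    (Metric.isOpen_ball.eventually_mem hq).mono hΩ
  have hqf := hh.mem_frontier hΩq (by rw [hh.map_add_smul, sub_self])
  refine (hh.norm_apply_le_of_isTangential hXn hΩq hA).trans ?_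
  gcongr
  rw [← dist_eq_norm]
  exact (hδX x (subset_closure hx) _ (frontier_subset_closure hqf)
    (by linarith [min_le_left δ (r / 2)])).le

end Chart

lemma IsLipschitzBoundaryPoint.integral_divergence_eq_zero {p : E d}
    (hp : IsLipschitzBoundaryPoint Ω p) (ho : IsOpen Ω) (hb : Bornology.IsBounded Ω) :
    ∃ r > 0, ∀ X : E d → E d, IsC1Closure Ω X → IsTangential Ω X →
      tsupport X ⊆ Metric.ball p r → ∫ x in Ω, divergence X x = 0 := by
  obtain ⟨e, L, h, hh, r, hr, hΩ⟩ := hp.exists_isDepthFunction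
  obtain ⟨M, hM⟩ := exists_lipschitzWith_smoothTransition
  refine ⟨r / 2, half_pos hr, fun X hX hXn hXs => ?_⟩
  have hball : Metric.ball p (r / 2) ⊆ Metric.ball p r :=
    Metric.ball_subset_ball (half_le_self hr.le)
  have hlim : Tendsto (fun m => ∫ x in Ω, depthCutoff h m x * divergence X x) atTop
      (𝓝 (∫ x in Ω, divergence X x)) := by
    refine tendsto_integral_depthCutoff_mul hh.lipschitzWith.continuous
      ((hX.extendsToClosure_divergence ho).integrableOn hb ho.measurableSet) ?_
    filter_upwards [ae_restrict_mem ho.measurableSet] with x hx hdiv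
    exact (hΩ x (hball (hXs (by_contra fun hxs =>
      hdiv (divergence_eq_zero_of_notMem_tsupport hxs))))).1 hx
  refine norm_le_zero_iff.1 (nonpos_of_forall_pos_le_mul
    (D := M * volume.real (Metric.ball p (r + 2)) * L) fun κ hκ => le_of_tendsto hlim.norm ?_)
  filter_upwards [hh.eventually_norm_apply_le hb hr hΩ hX.1 hXn hXs hκ, eventually_gt_atTop 0]
    with m hmκ hm
  rw [hh.integral_depthCutoff_mul_divergence hM ho hb hΩ hX (hXs.trans hball) hm, norm_neg,
    mul_assoc]
  exact hh.norm_integral_fderiv_depthCutoff_le hM ho.measurableSet (by positivity) hm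
    (fun x _ hXx => hball (hXs (subset_tsupport _ hXx))) hmκ

lemma integral_divergence_eq_zero_of_locally (ho : IsOpen Ω) (hb : Bornology.IsBounded Ω)
    {X : E d → E d} (hX : IsC1Closure Ω X)
    (hloc : ∀ p ∈ closure Ω ∩ tsupport X, ∃ r > 0, ∀ ψ : E d → ℝ, ContDiff ℝ ∞ ψ →
      tsupport ψ ⊆ Metric.ball p r → ∫ x in Ω, divergence (fun y => ψ y • X y) x = 0) :
    ∫ x in Ω, divergence X x = 0 := by
  choose! r hr hr0 using hloc
  have hK : IsCompact (closure Ω ∩ tsupport X) :=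
    hb.isCompact_closure.inter_right (isClosed_tsupport X)
  obtain ⟨t, ht, htK⟩ := hK.elim_nhds_subcover (fun p => Metric.ball p (r p))
    fun p hp => Metric.ball_mem_nhds p (hr p hp)
  obtain ⟨f, hf⟩ := SmoothPartitionOfUnity.exists_isSubordinate
    (modelWithCornersSelf ℝ (E d)) hK.isClosed (fun p : t => Metric.ball p.1 (r p.1))
    (fun _ => Metric.isOpen_ball) (by simpa [iUnion_subtype] using htK)
  have hfs : ∀ i, ContDiff ℝ ∞ (f i) := fun i => (f i).contMDiff.contDiff
  have hfX : ∀ i, IsC1Closure Ω fun x => f i x • X x := fun i =>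
    (IsC1Closure.of_contDiff ((hfs i).of_le (by exact_mod_cast le_top))).smul ho hX
  have hsum : ∀ x ∈ Ω, X x = ∑ i, f i x • X x := by
    intro x hx
    by_cases hxs : x ∈ tsupport X
    · have hone := f.sum_eq_one ⟨subset_closure hx, hxs⟩
      rw [finsum_eq_sum_of_fintype] at hone
      rw [← Finset.sum_smul, hone, one_smul]
    · simp [image_eq_zero_of_notMem_tsupport hxs]
  have hdiv : ∀ x ∈ Ω, divergence X x = ∑ i, divergence (fun y => f i y • X y) x := by
    intro x hx
    rw [divergence_congr ((ho.eventually_mem hx).mono hsum),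
      divergence_sum _ fun i _ => (hfX i).differentiableAt ho hx]
  rw [setIntegral_congr_fun ho.measurableSet hdiv, integral_finsetSum _ fun i _ =>
    ((hfX i).extendsToClosure_divergence ho).integrableOn hb ho.measurableSet]
  exact Finset.sum_eq_zero fun i _ => hr0 i.1 (ht i.1 i.2) _ (hfs i) (hf i)

end LocalDivergenceTheorem

section Capacity

section BallCover

variable {V : Type*} [MetricSpace V] {s : ℝ} {Z : Set V}

lemma exists_cover_tsum_ediam_rpow_lt [MeasurableSpace V] [BorelSpace V]
    (hZ : Measure.hausdorffMeasure s Z = 0) {r δ : ENNReal} (hr : 0 < r) (hδ : 0 < δ) :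
    ∃ t : ℕ → Set V, Z ⊆ ⋃ n, t n ∧ (∀ n, Metric.ediam (t n) ≤ r) ∧
      ∑' n, ⨆ _ : (t n).Nonempty, Metric.ediam (t n) ^ s < δ := by
  rw [Measure.hausdorffMeasure_apply] at hZ
  have hlt := ((le_iSup₂ (f := fun (r : ENNReal) (_ : 0 < r) =>
    ⨅ (t : ℕ → Set V) (_ : Z ⊆ ⋃ n, t n) (_ : ∀ n, Metric.ediam (t n) ≤ r),
      ∑' n, ⨆ _ : (t n).Nonempty, Metric.ediam (t n) ^ s) r hr).trans hZ.le).trans_lt hδ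
  simpa only [iInf_lt_iff, exists_prop] using hlt

lemma exists_ball_superset_rpow_le (hs : 0 ≤ s) (hne : Z.Nonempty) (hZ : Metric.ediam Z < 1)
    {δ : ENNReal} (hδ : δ ≠ 0) :
    ∃ (c : V) (r : ℝ), 0 < r ∧ r ≤ 1 ∧ Z ⊆ Metric.ball c r ∧
      ENNReal.ofReal (r ^ s) ≤ Metric.ediam Z ^ s + δ := by
  obtain ⟨c, hc⟩ := hne
  have hfin : Metric.ediam Z ≠ ⊤ := (hZ.trans_le le_top).ne
  have hdiam : ENNReal.ofReal (Metric.diam Z) = Metric.ediam Z := ENNReal.ofReal_toReal hfin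
  have hdiam_lt : Metric.diam Z < 1 := by
    rwa [← ENNReal.ofReal_lt_one, hdiam]
  have hlt : ENNReal.ofReal (Metric.diam Z ^ s) < Metric.ediam Z ^ s + δ := by
    rw [← ENNReal.ofReal_rpow_of_nonneg Metric.diam_nonneg hs, hdiam]
    exact ENNReal.lt_add_right (ENNReal.rpow_ne_top_of_nonneg hs hfin) hδ
  have hnear : ∀ᶠ r in 𝓝[>] Metric.diam Z, ENNReal.ofReal (r ^ s) < Metric.ediam Z ^ s + δ :=
    ((ENNReal.continuous_ofReal.comp (Real.continuous_rpow_const hs)).continuousWithinAt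
      |>.eventually_lt_const hlt)
  obtain ⟨r, hr, hdr, hr1⟩ := (hnear.and (eventually_mem_nhdsWithin.and
    (nhdsWithin_le_nhds (gt_mem_nhds hdiam_lt)))).exists
  exact ⟨c, r, Metric.diam_nonneg.trans_lt hdr, le_of_lt hr1, fun y hy =>
    (Metric.dist_le_diam_of_mem' hfin hy hc).trans_lt hdr, hr.le⟩

lemma exists_finite_ball_cover_sum_rpow_le [MeasurableSpace V] [BorelSpace V] (hs : 0 ≤ s)
    (hZ : IsCompact Z) (hZ0 : Measure.hausdorffMeasure s Z = 0) {δ : ℝ} (hδ : 0 < δ) :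
    ∃ (ι : Type) (t : Finset ι) (c : ι → V) (r : ι → ℝ), (∀ i, 0 < r i ∧ r i ≤ 1) ∧
      Z ⊆ ⋃ i ∈ t, Metric.ball (c i) (r i) ∧ ∑ i ∈ t, r i ^ s ≤ δ := by
  have hδ2 : (0 : ENNReal) < ENNReal.ofReal (δ / 2) := by simpa using hδ
  obtain ⟨T, hZT, hTd, hTs⟩ := exists_cover_tsum_ediam_rpow_lt hZ0
    (r := 2⁻¹) (by simp) hδ2
  obtain ⟨ε, hε, hεs⟩ := ENNReal.exists_pos_sum_of_countable hδ2.ne' ℕ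
  choose c r hr hr1 hTr hrs using fun n : {n // (T n).Nonempty} =>
    exists_ball_superset_rpow_le hs n.2 ((hTd n).trans_lt (by norm_num))
      (δ := ε n) (by exact_mod_cast (hε n).ne')
  obtain ⟨t, ht⟩ := hZ.elim_finite_subcover (fun n => Metric.ball (c n) (r n))
    (fun _ => Metric.isOpen_ball) fun z hz => by
      obtain ⟨n, hn⟩ := mem_iUnion.1 (hZT hz)
      exact mem_iUnion.2 ⟨⟨n, z, hn⟩, hTr ⟨n, z, hn⟩ hn⟩
  refine ⟨_, t, c, r, fun i => ⟨hr i, hr1 i⟩, ht, ?_⟩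
  rw [← ENNReal.ofReal_le_ofReal_iff hδ.le,
    ENNReal.ofReal_sum_of_nonneg fun i _ => Real.rpow_nonneg (hr i).le s]
  calc ∑ i ∈ t, ENNReal.ofReal (r i ^ s)
      ≤ ∑ i ∈ t, ((⨆ _ : (T i).Nonempty, Metric.ediam (T i) ^ s) + ε i) := by
        refine Finset.sum_le_sum fun i _ => ?_
        rw [iSup_pos i.2]
        exact hrs i
    _ = ∑ n ∈ t.map (Function.Embedding.subtype _),
          ((⨆ _ : (T n).Nonempty, Metric.ediam (T n) ^ s) + ε n) := by
        rw [Finset.sum_map]; rfl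
    _ ≤ (∑' n, ⨆ _ : (T n).Nonempty, Metric.ediam (T n) ^ s) + ∑' n, (ε n : ENNReal) := by
        rw [← ENNReal.tsum_add]
        exact ENNReal.sum_le_tsum _
    _ ≤ ENNReal.ofReal (δ / 2) + ENNReal.ofReal (δ / 2) := add_le_add hTs.le hεs.le
    _ = ENNReal.ofReal δ := by
        rw [← ENNReal.ofReal_add (by positivity) (by positivity), add_halves]

end BallCover

variable {V : Type*} [NormedAddCommGroup V] [NormedSpace ℝ V]

lemma norm_add_norm_fderiv_smoothTransition_sum_le {L : NNReal}
    (hL : LipschitzWith L Real.smoothTransition) {ι : Type*} (t : Finset ι) {b : ι → V → ℝ}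
    {K : ι → Set V} {D : ι → ℝ} (hb : ∀ i, Differentiable ℝ (b i))
    (hb01 : ∀ i x, 0 ≤ b i x ∧ b i x ≤ 1) (hbK : ∀ i, tsupport (b i) ⊆ K i)
    (hbD : ∀ i x, ‖fderiv ℝ (b i) x‖ ≤ D i) (x : V) :
    ‖Real.smoothTransition (∑ i ∈ t, b i x)‖
        + ‖fderiv ℝ (fun y => Real.smoothTransition (∑ i ∈ t, b i y)) x‖
      ≤ ∑ i ∈ t, (K i).indicator (fun _ => L * (1 + D i)) x := by
  have hsum : HasFDerivAt (fun y => ∑ i ∈ t, b i y) (∑ i ∈ t, fderiv ℝ (b i) x) x :=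
    .fun_sum fun i _ => (hb i x).hasFDerivAt
  have hderiv : fderiv ℝ (fun y => Real.smoothTransition (∑ i ∈ t, b i y)) x
      = deriv Real.smoothTransition (∑ i ∈ t, b i x) • ∑ i ∈ t, fderiv ℝ (b i) x :=
    (((Real.smoothTransition.contDiff (n := 1)).differentiable one_ne_zero
      _).hasDerivAt.comp_hasFDerivAt x hsum).fderiv
  have hval : ‖Real.smoothTransition (∑ i ∈ t, b i x)‖ ≤ L * ∑ i ∈ t, ‖b i x‖ := by
    have hdist := hL.dist_le_mul (∑ i ∈ t, b i x) 0
    rw [Real.smoothTransition.zero, dist_zero_right, dist_zero_right] at hdist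
    exact hdist.trans (by gcongr; exact norm_sum_le _ _)
  have hgrad : ‖fderiv ℝ (fun y => Real.smoothTransition (∑ i ∈ t, b i y)) x‖
      ≤ L * ∑ i ∈ t, ‖fderiv ℝ (b i) x‖ := by
    rw [hderiv, norm_smul]
    gcongr
    exacts [norm_deriv_le_of_lipschitz hL, norm_sum_le _ _]
  refine (add_le_add hval hgrad).trans ?_
  rw [← mul_add, ← Finset.sum_add_distrib, Finset.mul_sum]
  refine Finset.sum_le_sum fun i _ => ?_
  by_cases hx : x ∈ K i
  · rw [indicator_of_mem hx, Real.norm_of_nonneg (hb01 i x).1]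
    gcongr
    exacts [(hb01 i x).2, hbD i x]
  · have hxs : x ∉ tsupport (b i) := fun h => hx (hbK i h)
    simp [indicator_of_notMem hx, image_eq_zero_of_notMem_tsupport hxs,
      fderiv_of_notMem_tsupport (𝕜 := ℝ) hxs]

variable [FiniteDimensional ℝ V]

variable (V) in
lemma exists_contDiff_ball_cutoff :
    ∃ M : NNReal, ∀ (c : V) (r : ℝ), 0 < r → ∃ b : V → ℝ, ContDiff ℝ ∞ b ∧
      (∀ x, 0 ≤ b x ∧ b x ≤ 1) ∧ (∀ x ∈ Metric.ball c r, b x = 1) ∧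
      tsupport b ⊆ Metric.closedBall c (2 * r) ∧ ∀ x, ‖fderiv ℝ b x‖ ≤ M / r := by
  let β : ContDiffBump (0 : V) := ⟨1, 2, one_pos, one_lt_two⟩
  obtain ⟨M, hM⟩ := (β.contDiff (n := 1)).lipschitzWith_of_hasCompactSupport β.hasCompactSupport
    one_ne_zero
  refine ⟨M, fun c r hr => ⟨fun x => β (r⁻¹ • (x - c)), ?_, fun x => ⟨β.nonneg, β.le_one⟩,
    fun x hx => β.one_of_mem_closedBall ?_, closure_minimal (fun x hx => ?_)
    Metric.isClosed_closedBall, fun x => ?_⟩⟩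
  · exact β.contDiff.comp (contDiff_const.smul (contDiff_id.sub contDiff_const))
  · rw [mem_closedBall_zero_iff, norm_smul, norm_inv, Real.norm_of_nonneg hr.le,
      inv_mul_le_one₀ hr, ← dist_eq_norm]
    exact (Metric.mem_ball.1 hx).le
  · have hmem : r⁻¹ • (x - c) ∈ Metric.ball (0 : V) 2 := β.support_eq ▸ hx
    rw [mem_ball_zero_iff, norm_smul, norm_inv, Real.norm_of_nonneg hr.le,
      inv_mul_lt_iff₀ hr, ← dist_eq_norm, mul_comm] at hmem
    exact hmem.le
  · have hlip : LipschitzWith (M * ‖r⁻¹‖₊) fun x => β (r⁻¹ • (x - c)) :=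
      hM.comp (.of_dist_le_mul fun x y => by simp [dist_smul₀])
    simpa [abs_of_pos hr, div_eq_mul_inv] using norm_fderiv_le_of_lipschitz ℝ hlip (x₀ := x)

variable [MeasurableSpace V] [BorelSpace V] (μ : Measure V) [μ.IsAddHaarMeasure]

lemma integral_indicator_closedBall_le (hV : 1 ≤ Module.finrank ℝ V) {A : ℝ} (hA : 0 ≤ A)
    (c : V) {r : ℝ} (hr : 0 < r) (hr1 : r ≤ 1) :
    ∫ x, (Metric.closedBall c (2 * r)).indicator (fun _ => 1 + A / r) x ∂μ
      ≤ (1 + A) * (2 ^ Module.finrank ℝ V * μ.real (Metric.ball 0 1))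
        * r ^ ((Module.finrank ℝ V : ℝ) - 1) := by
  obtain ⟨k, hk⟩ := Nat.exists_eq_add_of_le' hV
  have hpow : r ^ ((Module.finrank ℝ V : ℝ) - 1) = r ^ k := by
    rw [hk, Nat.cast_add_one, add_sub_cancel_right, Real.rpow_natCast]
  have hinv : 1 + A / r ≤ (1 + A) / r := by
    rw [add_div]
    gcongr
    exact (one_le_div hr).2 hr1
  rw [integral_indicator_const _ Metric.isClosed_closedBall.measurableSet, smul_eq_mul, hpow,
    Measure.addHaar_real_closedBall _ _ (by positivity), mul_pow, hk, pow_succ r]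
  calc 2 ^ (k + 1) * (r ^ k * r) * μ.real (Metric.ball 0 1) * (1 + A / r)
      ≤ 2 ^ (k + 1) * (r ^ k * r) * μ.real (Metric.ball 0 1) * ((1 + A) / r) := by gcongr
    _ = _ := by field_simp

lemma integral_le_of_le_sum_indicator_closedBall (hV : 1 ≤ Module.finrank ℝ V) {ι : Type*}
    {t : Finset ι} {c : ι → V} {r : ι → ℝ} (hr : ∀ i, 0 < r i ∧ r i ≤ 1) {A K : ℝ} (hA : 0 ≤ A)
    (hK : 0 ≤ K) {g : V → ℝ} (hg0 : ∀ x, 0 ≤ g x)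
    (hg : ∀ x, g x ≤ ∑ i ∈ t,
      (Metric.closedBall (c i) (2 * r i)).indicator (fun _ => K * (1 + A / r i)) x) :
    ∫ x, g x ∂μ ≤ K * ((1 + A) * (2 ^ Module.finrank ℝ V * μ.real (Metric.ball 0 1)))
      * ∑ i ∈ t, r i ^ ((Module.finrank ℝ V : ℝ) - 1) := by
  have hint : ∀ i, Integrable ((Metric.closedBall (c i) (2 * r i)).indicator
      fun _ => K * (1 + A / r i)) μ := fun i =>
    (integrable_indicator_iff Metric.isClosed_closedBall.measurableSet).2
      (integrableOn_const measure_closedBall_lt_top.ne)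
  calc _ ≤ ∫ x, ∑ i ∈ t, (Metric.closedBall (c i) (2 * r i)).indicator
          (fun _ => K * (1 + A / r i)) x ∂μ :=
        integral_mono_of_nonneg (.of_forall hg0) (integrable_finsetSum t fun i _ => hint i)
          (.of_forall hg)
    _ = ∑ i ∈ t, K * ∫ x, (Metric.closedBall (c i) (2 * r i)).indicator
          (fun _ => 1 + A / r i) x ∂μ := by
        rw [integral_finsetSum t fun i _ => hint i]
        simp_rw [← integral_const_mul, ← indicator_const_mul]
    _ ≤ _ := by
        simp_rw [Finset.mul_sum, mul_assoc K]
        gcongr with i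
        exact integral_indicator_closedBall_le μ hV hA (c i) (hr i).1 (hr i).2

/-- A compact set of vanishing codimension-one Hausdorff measure has zero `W^{1,1}` capacity. -/
lemma exists_contDiff_eq_one_integral_le (hV : 1 ≤ Module.finrank ℝ V) {Z : Set V}
    (hZ : IsCompact Z)
    (hZ0 : Measure.hausdorffMeasure ((Module.finrank ℝ V : ℝ) - 1) Z = 0) {ε : ℝ} (hε : 0 < ε) :
    ∃ θ : V → ℝ, ContDiff ℝ ∞ θ ∧ HasCompactSupport θ ∧ (∀ᶠ x in 𝓝ˢ Z, θ x = 1) ∧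
      ∫ x, (‖θ x‖ + ‖fderiv ℝ θ x‖) ∂μ ≤ ε := by
  obtain ⟨L, hL⟩ := exists_lipschitzWith_smoothTransition
  obtain ⟨M, hM⟩ := exists_contDiff_ball_cutoff V
  set B : ℝ := L * ((1 + M) * (2 ^ Module.finrank ℝ V * μ.real (Metric.ball (0 : V) 1)))
  have hdim : (0 : ℝ) ≤ (Module.finrank ℝ V : ℝ) - 1 := sub_nonneg.2 (by exact_mod_cast hV)
  obtain ⟨ι, t, c, r, hr, hZt, hsum⟩ := exists_finite_ball_cover_sum_rpow_le hdim hZ hZ0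
    (δ := ε / (B + 1)) (by positivity)
  choose b hb hb01 hb1 hbs hbD using fun i => hM (c i) (r i) (hr i).1
  have hbound := norm_add_norm_fderiv_smoothTransition_sum_le hL t
    (fun i => (hb i).differentiable (by simp)) hb01 hbs hbD
  refine ⟨fun x => Real.smoothTransition (∑ i ∈ t, b i x),
    Real.smoothTransition.contDiff.comp (.sum fun i _ => hb i), ?_, ?_, ?_⟩
  · refine .intro (K := ⋃ i ∈ t, Metric.closedBall (c i) (2 * r i))
      (t.isCompact_biUnion fun i _ => isCompact_closedBall _ _) fun x hx => ?_
    rw [Finset.sum_eq_zero, Real.smoothTransition.zero]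
    exact fun i hi => image_eq_zero_of_notMem_tsupport fun h =>
      hx (mem_biUnion (Finset.mem_coe.2 hi) (hbs i h))
  · filter_upwards [(isOpen_biUnion fun i _ => Metric.isOpen_ball).mem_nhdsSet.2 hZt] with x hx
    obtain ⟨i, hi, hxi⟩ := mem_iUnion₂.1 hx
    exact Real.smoothTransition.one_of_one_le ((hb1 i x hxi).ge.trans
      (Finset.single_le_sum (f := fun i => b i x) (fun i _ => (hb01 i x).1) hi))
  calc _ ≤ B * ∑ i ∈ t, r i ^ ((Module.finrank ℝ V : ℝ) - 1) :=
        integral_le_of_le_sum_indicator_closedBall μ hV hr M.2 L.2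
          (fun x => by positivity) hbound
    _ ≤ B * (ε / (B + 1)) := by gcongr
    _ ≤ ε := by
        rw [mul_div_left_comm]
        exact mul_le_of_le_one_right hε.le (div_le_one_of_le₀ (by linarith) (by positivity))

end Capacity

section DivergenceTheorem

variable {d : ℕ} {Ω : Set (E d)} {X : E d → E d}

lemma norm_setIntegral_divergence_smul_le (ho : IsOpen Ω) {θ : E d → ℝ} (hθ : ContDiff ℝ 1 θ)
    (hc : HasCompactSupport θ) (hX : DifferentiableOn ℝ X Ω) {C D : ℝ}
    (hC : ∀ x ∈ Ω, ‖X x‖ ≤ C) (hD : ∀ x ∈ Ω, ‖divergence X x‖ ≤ D) (hC0 : 0 ≤ C) (hD0 : 0 ≤ D) :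
    ‖∫ x in Ω, divergence (fun y => θ y • X y) x‖
      ≤ (C + D) * ∫ x, (‖θ x‖ + ‖fderiv ℝ θ x‖) := by
  have hint : Integrable fun x => (C + D) * (‖θ x‖ + ‖fderiv ℝ θ x‖) :=
    (((hθ.continuous.integrable_of_hasCompactSupport hc).norm.add
      ((hθ.continuous_fderiv one_ne_zero).integrable_of_hasCompactSupport
        (hc.fderiv ℝ)).norm)).const_mul _
  have hbound : ∀ x ∈ Ω, ‖divergence (fun y => θ y • X y) x‖
      ≤ (C + D) * (‖θ x‖ + ‖fderiv ℝ θ x‖) := fun x hx => by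
    rw [divergence_smul (hθ.differentiable one_ne_zero x)
      (hX.differentiableAt (ho.mem_nhds hx))]
    have hgrad := (fderiv ℝ θ x).le_opNorm_of_le (hC x hx)
    have hval : ‖θ x * divergence X x‖ ≤ ‖θ x‖ * D := by
      rw [norm_mul]
      exact mul_le_mul_of_nonneg_left (hD x hx) (norm_nonneg _)
    nlinarith [norm_add_le (fderiv ℝ θ x (X x)) (θ x * divergence X x),
      mul_nonneg hC0 (norm_nonneg (θ x)), mul_nonneg hD0 (norm_nonneg (fderiv ℝ θ x))]
  calc _ ≤ ∫ x in Ω, (C + D) * (‖θ x‖ + ‖fderiv ℝ θ x‖) :=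
        norm_integral_le_of_norm_le hint.integrableOn
          ((ae_restrict_mem ho.measurableSet).mono hbound)
    _ ≤ ∫ x, (C + D) * (‖θ x‖ + ‖fderiv ℝ θ x‖) :=
        setIntegral_le_integral hint (.of_forall fun x => by positivity)
    _ = _ := integral_const_mul _ _

lemma integral_divergence_eq_zero_of_disjoint (ho : IsOpen Ω) (hb : Bornology.IsBounded Ω)
    (hreg : ∀ p ∈ frontier Ω ∩ tsupport X, IsLipschitzBoundaryPoint Ω p) (hX : IsC1Closure Ω X)
    (hXn : IsTangential Ω X) : ∫ x in Ω, divergence X x = 0 := by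
  refine integral_divergence_eq_zero_of_locally ho hb hX fun p ⟨hp, hpX⟩ => ?_
  by_cases hpΩ : p ∈ Ω
  · obtain ⟨r, hr, hrΩ⟩ := Metric.isOpen_iff.1 ho p hpΩ
    refine ⟨r, hr, fun ψ hψ hψs => ?_⟩
    have hψc : HasCompactSupport ψ := Metric.isCompact_of_isClosed_isBounded
      (isClosed_tsupport ψ) (Metric.isBounded_ball.subset hψs)
    obtain ⟨C, hC⟩ := hψ.lipschitzWith_of_hasCompactSupport hψc (by simp)
    obtain ⟨B, hB⟩ := hψc.exists_bound_of_continuous hψ.continuous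
    exact integral_divergence_smul_eq_zero_of_hasCompactSupport ho (hX.contDiffOn ho) hC
      (B := B.toNNReal) (fun x => (hB x).trans (Real.le_coe_toNNReal B)) hψc.smul_right
      ((tsupport_smul_subset_left ψ X).trans (hψs.trans hrΩ))
  · have hpf : p ∈ frontier Ω := ⟨hp, fun h => hpΩ (interior_subset h)⟩
    obtain ⟨r, hr, hloc⟩ := (hreg p ⟨hpf, hpX⟩).integral_divergence_eq_zero ho hb
    exact ⟨r, hr, fun ψ hψ hψs => hloc _
      ((IsC1Closure.of_contDiff (hψ.of_le (by exact_mod_cast le_top))).smul ho hX)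
      (hXn.smul ψ) ((tsupport_smul_subset_left ψ X).trans hψs)⟩

theorem IsAdmissibleDomain.integral_divergence_eq_zero (hd : 1 ≤ d) (hΩ : IsAdmissibleDomain Ω)
    (hX : IsC1Closure Ω X) (hXn : IsTangential Ω X) : ∫ x in Ω, divergence X x = 0 := by
  obtain ⟨ho, hb, Z₀, hZc, hZ0, hreg⟩ := hΩ
  have hZ : IsCompact (frontier Ω ∩ Z₀) :=
    (hb.isCompact_closure.of_isClosed_subset isClosed_frontier frontier_subset_closure).inter_right
      hZc
  obtain ⟨C, hC0, hC⟩ := hX.extendsToClosure.exists_bound hb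
  obtain ⟨D, hD0, hD⟩ := (hX.extendsToClosure_divergence ho).exists_bound hb
  refine norm_le_zero_iff.1 (nonpos_of_forall_pos_le_mul (D := C + D) fun ε hε => ?_)
  obtain ⟨θ, hθ, hθc, hθZ, hθε⟩ := exists_contDiff_eq_one_integral_le volume
    (by simpa using hd) hZ (by simpa using measure_mono_null inter_subset_right hZ0) hε
  have hθ1 : ContDiff ℝ 1 θ := hθ.of_le (by exact_mod_cast le_top)
  have hθX := (IsC1Closure.of_contDiff (Ω := Ω) hθ1).smul ho hX
  have hθ'X := (IsC1Closure.of_contDiff (Ω := Ω)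
    ((contDiff_const (c := (1 : ℝ))).sub hθ1)).smul ho hX
  have hzero : ∫ x in Ω, divergence (fun y => ((1 : ℝ) - θ y) • X y) x = 0 := by
    refine integral_divergence_eq_zero_of_disjoint ho hb (fun p ⟨hpf, hpX⟩ => hreg p ⟨hpf, ?_⟩)
      hθ'X (hXn.smul _)
    intro hpZ
    refine notMem_tsupport_iff_eventuallyEq.2 ?_
      (tsupport_smul_subset_left (fun y => (1 : ℝ) - θ y) X hpX)
    filter_upwards [eventually_nhdsSet_iff_forall.1 hθZ p ⟨hpf, hpZ⟩] with y hy
    simp [hy]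
  have hsplit : ∀ x ∈ Ω, divergence X x = divergence (fun y => ((1 : ℝ) - θ y) • X y) x
      + divergence (fun y => θ y • X y) x := fun x hx => by
    rw [divergence_smul ((hθ1.differentiable one_ne_zero x).const_sub 1)
        (hX.differentiableAt ho hx), divergence_smul (hθ1.differentiable one_ne_zero x)
        (hX.differentiableAt ho hx), fderiv_const_sub, neg_apply]
    ring
  rw [setIntegral_congr_fun ho.measurableSet hsplit, integral_add
    ((hθ'X.extendsToClosure_divergence ho).integrableOn hb ho.measurableSet)
    ((hθX.extendsToClosure_divergence ho).integrableOn hb ho.measurableSet), hzero, zero_add]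
  exact (norm_setIntegral_divergence_smul_le ho hθ1 hθc (fun x hx =>
    (hX.differentiableAt ho hx).differentiableWithinAt) hC hD hC0 hD0).trans (by gcongr)

end DivergenceTheorem

section Approximation

lemma exists_contDiff_top_norm_sub_le {V F : Type*} [NormedAddCommGroup V] [NormedSpace ℝ V]
    [FiniteDimensional ℝ V] [NormedAddCommGroup F] [NormedSpace ℝ F] [CompleteSpace F]
    {Ω : Set V} (ho : IsOpen Ω) {X : V → F} (hX : ContDiff ℝ 1 X) (hc : HasCompactSupport X)
    (hs : tsupport X ⊆ Ω) {ε : ℝ} (hε : 0 < ε) :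
    ∃ Y : V → F, ContDiff ℝ ∞ Y ∧ HasCompactSupport Y ∧ tsupport Y ⊆ Ω ∧
      ∀ x, ‖Y x - X x‖ ≤ ε ∧ ‖fderiv ℝ Y x - fderiv ℝ X x‖ ≤ ε := by
  borelize V
  let μ : Measure V := Measure.addHaar
  have hX' : Continuous (fderiv ℝ X) := hX.continuous_fderiv one_ne_zero
  obtain ⟨δ₁, hδ₁, hXδ⟩ := Metric.uniformContinuous_iff.1
    (hX.continuous.uniformContinuous_of_tendsto_cocompact hc.is_zero_at_infty) ε hε
  obtain ⟨δ₂, hδ₂, hX'δ⟩ := Metric.uniformContinuous_iff.1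
    (hX'.uniformContinuous_of_tendsto_cocompact (hc.fderiv (𝕜 := ℝ)).is_zero_at_infty) ε hε
  obtain ⟨δ₃, hδ₃, hΩδ⟩ := IsCompact.exists_cthickening_subset_open hc ho hs
  obtain ⟨δ, hδ, hδmin⟩ := exists_between (lt_min hδ₁ (lt_min hδ₂ hδ₃))
  obtain ⟨hδ1, hδ2, hδ3⟩ : δ < δ₁ ∧ δ < δ₂ ∧ δ < δ₃ := by simpa [lt_min_iff] using hδmin
  let φ : ContDiffBump (0 : V) := ⟨δ / 2, δ, half_pos hδ, half_lt_self hδ⟩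
  let Y : V → F := convolution (φ.normed μ) X (ContinuousLinearMap.lsmul ℝ ℝ) μ
  have hYs : tsupport Y ⊆ Metric.cthickening δ₃ (tsupport X) := by
    refine closure_minimal ((support_convolution_subset _).trans ?_) Metric.isClosed_cthickening
    rintro _ ⟨a, ha, b, hb, rfl⟩
    rw [φ.support_normed_eq, mem_ball_zero_iff] at ha
    refine Metric.mem_cthickening_of_dist_le _ b _ _ (subset_tsupport _ hb) ?_
    rw [dist_eq_norm, add_sub_cancel_right]
    exact (ha.trans hδ3).le
  refine ⟨Y, φ.hasCompactSupport_normed.contDiff_convolution_left _ φ.contDiff_normed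
    hX.continuous.locallyIntegrable, φ.hasCompactSupport_normed.convolution _ hc,
    hYs.trans hΩδ, fun x => ⟨?_, ?_⟩⟩
  · rw [← dist_eq_norm]
    exact φ.dist_normed_convolution_le hX.continuous.aestronglyMeasurable fun y hy =>
      (hXδ (hy.trans hδ1)).le
  · have hY' : fderiv ℝ Y x = convolution (φ.normed μ) (fderiv ℝ X)
        (ContinuousLinearMap.lsmul ℝ ℝ) μ x :=
      (hc.hasFDerivAt_convolution_right (ContinuousLinearMap.lsmul ℝ ℝ)
        φ.continuous_normed.locallyIntegrable hX x).fderiv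
    rw [hY', ← dist_eq_norm]
    exact φ.dist_normed_convolution_le hX'.aestronglyMeasurable fun y hy =>
      (hX'δ (hy.trans hδ2)).le

variable (F : Type*) [NormedAddCommGroup F] [NormedSpace ℝ F] [FiniteDimensional ℝ F]

lemma exists_contDiff_truncation :
    ∃ (M : NNReal) (T : F → F), ContDiff ℝ ∞ T ∧ LipschitzWith M T ∧
      (∀ w, ‖w‖ ≤ 1 → T w = 0) ∧ ∀ w, 2 ≤ ‖w‖ → T w = w := by
  let β : ContDiffBump (0 : F) := ⟨1, 2, one_pos, one_lt_two⟩
  have hβ : ContDiff ℝ ∞ fun w => β w • w := β.contDiff.smul contDiff_id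
  obtain ⟨M, hM⟩ := hβ.lipschitzWith_of_hasCompactSupport β.hasCompactSupport.smul_right
    (by simp)
  refine ⟨1 + M, fun w => w - β w • w, contDiff_id.sub hβ, LipschitzWith.id.sub hM,
    fun w hw => ?_, fun w hw => ?_⟩
  · simp [β.one_of_mem_closedBall (mem_closedBall_zero_iff.2 hw)]
  · simp [β.zero_of_le_dist (by simpa using hw)]

lemma exists_truncation_seq :
    ∃ (M : NNReal) (T : ℕ → F → F), (∀ k, ContDiff ℝ ∞ (T k)) ∧ (∀ k, LipschitzWith M (T k)) ∧
      (∀ k : ℕ, ∀ w, ‖w‖ ≤ 1 / ((k : ℝ) + 1) → T k w = 0) ∧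
      ∀ w, w ≠ 0 → ∀ᶠ k in atTop, T k =ᶠ[𝓝 w] id := by
  obtain ⟨M, T, hT, hTM, hT0, hT1⟩ := exists_contDiff_truncation F
  have hpos : ∀ k : ℕ, (0 : ℝ) < (k : ℝ) + 1 := fun k => by positivity
  have hnorm : ∀ (k : ℕ) (w : F), ‖((k : ℝ) + 1) • w‖ = ((k : ℝ) + 1) * ‖w‖ := fun k w => by
    rw [norm_smul, Real.norm_of_nonneg (hpos k).le]
  refine ⟨M, fun k w => ((k : ℝ) + 1)⁻¹ • T (((k : ℝ) + 1) • w),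
    fun k => (hT.comp (contDiff_id.const_smul ((k : ℝ) + 1))).const_smul _,
    fun k => .of_dist_le_mul fun x y => ?_, fun k w hw => ?_, fun w hw => ?_⟩
  · rw [dist_smul₀, norm_inv, Real.norm_of_nonneg (hpos k).le, inv_mul_le_iff₀ (hpos k)]
    refine (hTM.dist_le_mul _ _).trans_eq ?_
    rw [dist_smul₀, Real.norm_of_nonneg (hpos k).le, mul_left_comm]
  · dsimp only
    rw [hT0, smul_zero]
    rwa [hnorm, mul_comm, ← le_div_iff₀ (hpos k)]
  · have hlarge : ∀ᶠ k : ℕ in atTop, 2 < ((k : ℝ) + 1) * ‖w‖ :=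
      ((tendsto_natCast_atTop_atTop.atTop_add tendsto_const_nhds).atTop_mul_const
        (norm_pos_iff.2 hw)).eventually_gt_atTop 2
    filter_upwards [hlarge] with k hk
    have hcont : Continuous fun y : F => ((k : ℝ) + 1) * ‖y‖ := by fun_prop
    filter_upwards [hcont.continuousAt.eventually_const_lt hk] with y hy
    rw [hT1 _ (by rw [hnorm]; exact hy.le), inv_smul_smul₀ (hpos k).ne', id_eq]

end Approximation

lemma tendsto_truncation_and_fderiv_comp {V F : Type*} [NormedAddCommGroup V] [NormedSpace ℝ V]
    [NormedAddCommGroup F] [NormedSpace ℝ F] {T : ℕ → F → F} (hT0 : ∀ k, T k 0 = 0)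
    (hTid : ∀ w, w ≠ 0 → ∀ᶠ k in atTop, T k =ᶠ[𝓝 w] id) {w : F} {A : V →L[ℝ] F}
    (hA : w = 0 → A = 0) :
    Tendsto (fun k => T k w) atTop (𝓝 w) ∧
      Tendsto (fun k => (fderiv ℝ (T k) w).comp A) atTop (𝓝 A) := by
  rcases eq_or_ne w 0 with rfl | hw
  · simp [hT0, hA rfl]
  · refine ⟨tendsto_const_nhds.congr' ?_, tendsto_const_nhds.congr' ?_⟩ <;>
      filter_upwards [hTid w hw] with k hk
    · exact hk.eq_of_nhds.symm
    · rw [hk.fderiv_eq, fderiv_id, ContinuousLinearMap.id_comp]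

lemma tsupport_comp_indicator_subset {X F G : Type*} [TopologicalSpace X] [NormedAddCommGroup F]
    [Zero G] {Ω : Set X} {v : X → F} {T : F → G} {ε : ℝ} (hε : 0 < ε)
    (hT : ∀ w, ‖w‖ ≤ ε → T w = 0) (hv : Continuous (Ω.indicator v)) :
    tsupport (T ∘ Ω.indicator v) ⊆ Ω := by
  have hclosed : IsClosed {x | ε ≤ ‖Ω.indicator v x‖} := isClosed_le continuous_const hv.norm
  refine (closure_minimal (fun x hx => ?_) hclosed).trans fun x hx => ?_
  · exact not_lt.1 fun hlt => hx (hT _ hlt.le)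
  · by_contra hxΩ
    rw [mem_ofPred_eq, indicator_of_notMem hxΩ, norm_zero] at hx
    exact hx.not_gt hε

lemma ae_fderiv_eq_zero_of_eq_zero {V : Type*} [NormedAddCommGroup V] [NormedSpace ℝ V]
    [FiniteDimensional ℝ V] [MeasurableSpace V] [BorelSpace V] (μ : Measure V)
    [μ.IsAddHaarMeasure] {Ω : Set V} (ho : IsOpen Ω) {v : V → V} (hv : DifferentiableOn ℝ v Ω) :
    ∀ᵐ x ∂(μ.restrict Ω), v x = 0 → fderiv ℝ v x = 0 := by
  have hmeas : MeasurableSet {x ∈ Ω | v x = 0} := by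
    obtain ⟨u, hu, huv⟩ := (continuousOn_iff_isClosed.1 hv.continuousOn) {0} isClosed_singleton
    have heq : {x ∈ Ω | v x = 0} = v ⁻¹' {0} ∩ Ω := inter_comm _ _
    rw [heq, huv]
    exact hu.measurableSet.inter ho.measurableSet
  have happrox : ApproximatesLinearOn v (0 : V →L[ℝ] V) {x ∈ Ω | v x = 0} 0 := by
    rintro x ⟨-, hx⟩ y ⟨-, hy⟩
    simp [hx, hy]
  have hzero := happrox.norm_fderiv_sub_le μ hmeas (fderiv ℝ v) fun x hx =>
    (hv.differentiableAt (ho.mem_nhds hx.1)).hasFDerivAt.hasFDerivWithinAt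
  rw [ae_restrict_iff' hmeas] at hzero
  rw [ae_restrict_iff' ho.measurableSet]
  filter_upwards [hzero] with x hx hxΩ hvx
  simpa using hx ⟨hxΩ, hvx⟩

section DominatedLimits

variable {α : Type*} [MeasurableSpace α] {μ : Measure α} {C : ℝ}

lemma tendsto_integral_inner {F : Type*} [NormedAddCommGroup F] [InnerProductSpace ℝ F]
    {D X : α → F} {Y : ℕ → α → F} (hD : Integrable D μ) (hY : ∀ n, AEStronglyMeasurable (Y n) μ)
    (hC : ∀ n, ∀ᵐ x ∂μ, ‖Y n x‖ ≤ C)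
    (hlim : ∀ᵐ x ∂μ, Tendsto (fun n => Y n x) atTop (𝓝 (X x))) :
    Tendsto (fun n => ∫ x, inner ℝ (D x) (Y n x) ∂μ) atTop (𝓝 (∫ x, inner ℝ (D x) (X x) ∂μ)) := by
  refine tendsto_integral_of_dominated_convergence (fun x => ‖D x‖ * C)
    (fun n => hD.aestronglyMeasurable.inner (hY n)) (hD.norm.mul_const C) (fun n => ?_)
    (hlim.mono fun x hx => tendsto_const_nhds.inner hx)
  filter_upwards [hC n] with x hx
  exact (norm_inner_le_norm _ _).trans (by gcongr)

lemma tendsto_integral_frob {d : ℕ} {M B : α → Matrix (Fin d) (Fin d) ℝ}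
    {A : ℕ → α → Matrix (Fin d) (Fin d) ℝ} (hM : ∀ i j, Integrable (fun x => M x i j) μ)
    (hA : ∀ n i j, AEStronglyMeasurable (fun x => A n x i j) μ)
    (hC : ∀ n, ∀ᵐ x ∂μ, ∀ i j, ‖A n x i j‖ ≤ C)
    (hlim : ∀ᵐ x ∂μ, ∀ i j, Tendsto (fun n => A n x i j) atTop (𝓝 (B x i j))) :
    Tendsto (fun n => ∫ x, frob (M x) (A n x) ∂μ) atTop (𝓝 (∫ x, frob (M x) (B x) ∂μ)) := by
  refine tendsto_integral_of_dominated_convergence (fun x => ∑ i, ∑ j, ‖M x i j‖ * C)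
    (fun n => ?_) (integrable_finsetSum _ fun i _ => integrable_finsetSum _ fun j _ =>
      (hM i j).norm.mul_const C) (fun n => ?_) ?_
  · exact Finset.aestronglyMeasurable_fun_sum _ fun i _ =>
      Finset.aestronglyMeasurable_fun_sum _ fun j _ => (hM i j).aestronglyMeasurable.mul (hA n i j)
  · filter_upwards [hC n] with x hx
    refine norm_sum_le_of_le _ fun i _ => norm_sum_le_of_le _ fun j _ => ?_
    rw [norm_mul]
    exact mul_le_mul_of_nonneg_left (hx i j) (norm_nonneg _)
  · filter_upwards [hlim] with x hx
    exact tendsto_finsetSum _ fun i _ => tendsto_finsetSum _ fun j _ => (hx i j).const_mul _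

end DominatedLimits

section WeakDivergence

variable {d : ℕ} {Ω : Set (E d)} {M : E d → Matrix (Fin d) (Fin d) ℝ} {D : E d → E d}

lemma norm_jacobian_apply_le {v : E d → E d} {x : E d} (hv : DifferentiableAt ℝ v x)
    (i j : Fin d) : ‖jacobian v x i j‖ ≤ ‖fderiv ℝ v x‖ := by
  rw [jacobian_apply hv]
  exact (PiLp.norm_apply_le _ i).trans ((fderiv ℝ v x).unit_le_opNorm _ (by simp))

lemma integral_inner_eq_of_tendsto (ho : IsOpen Ω) (hD : IntegrableOn D Ω)
    (hM : ∀ i j, IntegrableOn (fun x => M x i j) Ω) {Y : ℕ → E d → E d} {X : E d → E d}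
    (hY : ∀ n, ContDiff ℝ 1 (Y n)) {C : ℝ}
    (hC : ∀ n, ∀ x ∈ Ω, ‖Y n x‖ ≤ C ∧ ‖fderiv ℝ (Y n) x‖ ≤ C) (hX : DifferentiableOn ℝ X Ω)
    (hlim : ∀ᵐ x ∂(volume.restrict Ω), Tendsto (fun n => Y n x) atTop (𝓝 (X x)) ∧
      Tendsto (fun n => fderiv ℝ (Y n) x) atTop (𝓝 (fderiv ℝ X x)))
    (heq : ∀ n, ∫ x in Ω, inner ℝ (D x) (Y n x) = -∫ x in Ω, frob (M x) (jacobian (Y n) x)) :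
    ∫ x in Ω, inner ℝ (D x) (X x) = -∫ x in Ω, frob (M x) (jacobian X x) := by
  have hYd : ∀ n x, DifferentiableAt ℝ (Y n) x := fun n x => (hY n).differentiable one_ne_zero x
  have hinner := tendsto_integral_inner hD
    (fun n => (hY n).continuous.aestronglyMeasurable)
    (fun n => (ae_restrict_mem ho.measurableSet).mono fun x hx => (hC n x hx).1)
    (hlim.mono fun x hx => hx.1)
  have hentry : ∀ i j : Fin d, Continuous fun A : E d →L[ℝ] E d =>
      A (EuclideanSpace.single j 1) i := fun i j =>
    (EuclideanSpace.proj (𝕜 := ℝ) i).continuous.comp (continuous_eval_const _)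
  have hfrob : Tendsto (fun n => ∫ x in Ω, frob (M x) (jacobian (Y n) x)) atTop
      (𝓝 (∫ x in Ω, frob (M x) (jacobian X x))) := by
    refine tendsto_integral_frob (C := C) hM (fun n i j => ?_) (fun n => ?_) ?_
    · simp only [jacobian_apply (hYd n _)]
      exact ((hentry i j).comp ((hY n).continuous_fderiv one_ne_zero)).aestronglyMeasurable
    · filter_upwards [ae_restrict_mem ho.measurableSet] with x hx i j
      exact (norm_jacobian_apply_le (hYd n x) i j).trans (hC n x hx).2
    · filter_upwards [hlim, ae_restrict_mem ho.measurableSet] with x hx hxΩ i j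
      simp only [jacobian_apply (hYd _ _),
        jacobian_apply (hX.differentiableAt (ho.mem_nhds hxΩ))]
      exact ((hentry i j).tendsto _).comp hx.2
  exact tendsto_nhds_unique hinner (hfrob.neg.congr fun n => (heq n).symm)

namespace IsWeakTensorDivergence

lemma integral_eq_of_contDiff_one (hMD : IsWeakTensorDivergence Ω M D) (ho : IsOpen Ω)
    (hD : IntegrableOn D Ω) (hM : ∀ i j, IntegrableOn (fun x => M x i j) Ω)
    {X : E d → E d} (hX : ContDiff ℝ 1 X) (hc : HasCompactSupport X) (hs : tsupport X ⊆ Ω) :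
    ∫ x in Ω, inner ℝ (D x) (X x) = -∫ x in Ω, frob (M x) (jacobian X x) := by
  choose Y hY hYc hYs hYX using fun n : ℕ =>
    exists_contDiff_top_norm_sub_le ho hX hc hs (Nat.one_div_pos_of_nat (α := ℝ) (n := n))
  obtain ⟨C₁, hC₁⟩ := hX.continuous.bounded_above_of_compact_support hc
  obtain ⟨C₂, hC₂⟩ := (hX.continuous_fderiv one_ne_zero).bounded_above_of_compact_support
    (hc.fderiv (𝕜 := ℝ))
  have hle : ∀ n : ℕ, 1 / ((n : ℝ) + 1) ≤ 1 := fun n => by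
    rw [div_le_one (by positivity)]
    linarith [n.cast_nonneg (α := ℝ)]
  refine integral_inner_eq_of_tendsto ho hD hM (fun n => (hY n).of_le (by exact_mod_cast le_top))
    (C := max C₁ C₂ + 1) (fun n x _ => ⟨?_, ?_⟩) (hX.differentiable one_ne_zero).differentiableOn
    (.of_forall fun x => ⟨?_, ?_⟩) fun n => hMD.integral_eq _ (hY n) (hYc n) (hYs n)
  · linarith [norm_le_norm_add_norm_sub' (Y n x) (X x), hYX n x, hle n, hC₁ x, le_max_left C₁ C₂]
  · linarith [norm_le_norm_add_norm_sub' (fderiv ℝ (Y n) x) (fderiv ℝ X x), hYX n x, hle n, hC₂ x,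
      le_max_right C₁ C₂]
  · exact tendsto_iff_norm_sub_tendsto_zero.2 (squeeze_zero (fun _ => norm_nonneg _)
      (fun n => (hYX n x).1) tendsto_one_div_add_atTop_nhds_zero_nat)
  · exact tendsto_iff_norm_sub_tendsto_zero.2 (squeeze_zero (fun _ => norm_nonneg _)
      (fun n => (hYX n x).2) tendsto_one_div_add_atTop_nhds_zero_nat)

/-- The truncations `T k ∘ v` are compactly supported in `Ω` and converge to `v` in the sense
required, because `∇v = 0` almost everywhere on `{v = 0}`. -/
theorem integral_eq_of_frontier_eq_zero (hMD : IsWeakTensorDivergence Ω M D) (ho : IsOpen Ω)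
    (hb : Bornology.IsBounded Ω) (hD : IntegrableOn D Ω)
    (hM : ∀ i j, IntegrableOn (fun x => M x i j) Ω) {v : E d → E d} (hv : IsC1Closure Ω v)
    (hv0 : ∀ x ∈ frontier Ω, v x = 0) :
    ∫ x in Ω, inner ℝ (D x) (v x) = -∫ x in Ω, frob (M x) (jacobian v x) := by
  obtain ⟨L, T, hT, hTL, hT0, hTid⟩ := exists_truncation_seq (E d)
  have hT0' : ∀ k, T k 0 = 0 := fun k => hT0 k 0 (by rw [norm_zero]; positivity)
  set w : E d → E d := Ω.indicator v
  have hwc : Continuous w := continuous_indicator hv0 hv.1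
  have hwv : EqOn w v Ω := fun x hx => indicator_of_mem hx v
  have hsupp : ∀ k, tsupport (T k ∘ w) ⊆ Ω := fun k =>
    tsupport_comp_indicator_subset (by positivity) (hT0 k) hwc
  have hsmooth : ∀ k, ContDiff ℝ 1 (T k ∘ w) := fun k =>
    contDiff_of_contDiffOn_of_tsupport_subset ho (((hT k).of_le (mod_cast le_top)).comp_contDiffOn
      ((hv.contDiffOn ho).congr hwv)) (hsupp k)
  have hderiv : ∀ k, ∀ x ∈ Ω, fderiv ℝ (T k ∘ w) x = (fderiv ℝ (T k) (v x)).comp (fderiv ℝ v x) :=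
    fun k x hx => by
      have hev : T k ∘ w =ᶠ[𝓝 x] T k ∘ v :=
        (hwv.eventuallyEq_of_mem (ho.mem_nhds hx)).fun_comp (T k)
      rw [hev.fderiv_eq, fderiv_comp x ((hT k).differentiable (by simp) _)
        (hv.differentiableAt ho hx)]
  obtain ⟨C₁, -, hC₁⟩ := hv.extendsToClosure.exists_bound hb
  obtain ⟨C₂, -, hC₂⟩ := hv.extendsToClosure_fderiv.exists_bound hb
  refine integral_inner_eq_of_tendsto ho hD hM hsmooth (C := L * max C₁ C₂)
    (fun k x hx => ⟨?_, ?_⟩) (fun x hx => (hv.differentiableAt ho hx).differentiableWithinAt) ?_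
    fun k => hMD.integral_eq_of_contDiff_one ho hD hM (hsmooth k)
      (Metric.isCompact_of_isClosed_isBounded (isClosed_tsupport _) (hb.subset (hsupp k))) (hsupp k)
  · have hlip := (hTL k).dist_le_mul (w x) 0
    rw [hT0', dist_zero_right, dist_zero_right, hwv hx] at hlip
    rw [Function.comp_apply, hwv hx]
    exact hlip.trans (by gcongr; exact (hC₁ x hx).trans (le_max_left _ _))
  · rw [hderiv k x hx]
    refine (ContinuousLinearMap.opNorm_comp_le _ _).trans ?_
    gcongr
    exacts [norm_fderiv_le_of_lipschitz ℝ (hTL k), (hC₂ x hx).trans (le_max_right _ _)]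
  filter_upwards [ae_restrict_mem ho.measurableSet,
    ae_fderiv_eq_zero_of_eq_zero volume ho fun x hx =>
      (hv.differentiableAt ho hx).differentiableWithinAt] with x hx hx0
  simpa only [hderiv _ x hx, Function.comp_apply, hwv hx] using
    tendsto_truncation_and_fderiv_comp hT0' hTid hx0

end IsWeakTensorDivergence

end WeakDivergence

section Momentum

variable {d : ℕ} {Ω : Set (E d)}

lemma fderiv_norm_sq_apply {u : E d → E d} {x : E d} (hu : DifferentiableAt ℝ u x) (w : E d) :
    fderiv ℝ (fun y => ‖u y‖ ^ 2) x w = 2 * inner ℝ (u x) (fderiv ℝ u x w) := by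
  rw [hu.hasFDerivAt.norm_sq.fderiv]
  simp

lemma IsC1Closure.norm_sq (ho : IsOpen Ω) {u : E d → E d} (hu : IsC1Closure Ω u) :
    IsC1Closure Ω (fun x => ‖u x‖ ^ 2) :=
  .of_hasFDerivAt (hu.1.norm.pow 2)
    (fun _ hx => (hu.differentiableAt ho hx).hasFDerivAt.norm_sq)
    (hu.extendsToClosure.comp₂ (Φ := fun p : E d × (E d →L[ℝ] E d) =>
        2 • (innerSL ℝ p.1).comp p.2)
      ((((innerSL ℝ).continuous.comp continuous_fst).clm_comp continuous_snd).const_smul 2)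
      hu.extendsToClosure_fderiv)

lemma tensorDivergence_tensor {a b : E d → E d} {x : E d} (ha : DifferentiableAt ℝ a x)
    (hb : DifferentiableAt ℝ b x) :
    tensorDivergence (fun y => tensor (a y) (b y)) x
      = divergence b x • a x + fderiv ℝ a x (b x) := by
  have hcoord : ∀ {u : E d → E d} (i : Fin d), DifferentiableAt ℝ u x →
      DifferentiableAt ℝ (fun y => u y i) x :=
    fun i hu => (EuclideanSpace.proj (𝕜 := ℝ) i).differentiableAt.comp x hu
  ext i
  rw [map_eq_sum_coord (fderiv ℝ a x) (b x), divergence_eq hb]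
  simp [tensorDivergence, tensor, pderiv, fderiv_fun_mul (hcoord i ha) (hcoord _ hb),
    fderiv_coord ha, fderiv_coord hb, Finset.sum_add_distrib, Finset.mul_sum, mul_comm]

lemma tensorDivergence_smul_tensor {a : E d → ℝ} {u : E d → E d} {x : E d}
    (ha : DifferentiableAt ℝ a x) (hu : DifferentiableAt ℝ u x) :
    tensorDivergence (fun y => a y • tensor (u y) (u y)) x
      = divergence (fun y => a y • u y) x • u x + a x • fderiv ℝ u x (u x) := by
  have htensor : (fun y => a y • tensor (u y) (u y)) = fun y => tensor (u y) (a y • u y) := by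
    ext y i j
    simp [tensor, mul_left_comm]
  rw [htensor, tensorDivergence_tensor hu (ha.fun_smul hu), map_smul]

lemma IsWeakTensorDivergence.congr_ae {M : E d → Matrix (Fin d) (Fin d) ℝ} {D G : E d → E d}
    (hMD : IsWeakTensorDivergence Ω M D) (hDG : D =ᵐ[volume.restrict Ω] G)
    (hG : LocallyIntegrableOn G Ω) : IsWeakTensorDivergence Ω M G where
  locallyIntegrable_field := hMD.locallyIntegrable_field
  locallyIntegrable_div := hG
  integral_eq X hX hc hs := by
    rw [← hMD.integral_eq X hX hc hs]
    refine integral_congr_ae ?_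
    filter_upwards [hDG] with x hx
    rw [hx]

end Momentum

section Mean

lemma inner_sub_half_smul_add {F : Type*} [NormedAddCommGroup F] [InnerProductSpace ℝ F]
    (a b : F) : inner ℝ (b - a) ((1 / 2 : ℝ) • (b + a)) = 1 / 2 * (‖b‖ ^ 2 - ‖a‖ ^ 2) := by
  simp only [real_inner_smul_right, inner_add_right, inner_sub_left, real_inner_self_eq_norm_sq,
    real_inner_comm a b]
  ring

variable {d : ℕ} {Ω : Set (E d)} {U V : Fields d}

lemma IsC1Closure.mean (ho : IsOpen Ω) {u v : E d → ℝ} (hu : IsC1Closure Ω u)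
    (hv : IsC1Closure Ω v) : IsC1Closure Ω (fun x => (v x + u x) / 2) := by
  simpa [div_eq_inv_mul] using (hv.add ho hu).const_smul ho (1 / 2)

lemma Fields.IsAdmissible.mid (ho : IsOpen Ω) (hU : U.IsAdmissible Ω) (hV : V.IsAdmissible Ω) :
    (U.mid V).IsAdmissible Ω where
  c1_ρ := hU.c1_ρ.mean ho hV.c1_ρ
  c1_v := (hV.c1_v.add ho hU.c1_v).const_smul ho _
  c1_φ := hU.c1_φ.mean ho hV.c1_φ
  c1_μ := hU.c1_μ.mean ho hV.c1_μ
  c1_τ := hU.c1_τ.mean ho hV.c1_τ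
  c1_σ := (hV.c1_σ.add ho hU.c1_σ).const_smul ho _
  ρ_pos x hx := half_pos (add_pos (hV.ρ_pos x hx) (hU.ρ_pos x hx))
  v_boundary x hx := by simp [Fields.mid, hU.v_boundary x hx, hV.v_boundary x hx]
  σ_boundary x hx n hn := by
    simp [Fields.mid, real_inner_smul_left, inner_add_left, hU.σ_boundary x hx n hn,
      hV.σ_boundary x hx n hn]

end Mean

section OneStep

variable {d : ℕ} {Ω : Set (E d)} {f : ℝ → ℝ → ℝ}
  {S : ℝ → Matrix (Fin d) (Fin d) ℝ → Matrix (Fin d) (Fin d) ℝ} {γ η Δt : ℝ}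
  {U V W : Fields d}

lemma Fields.IsAdmissible.integrableOn_energyDensity (hU : U.IsAdmissible Ω) (ho : IsOpen Ω)
    (hb : Bornology.IsBounded Ω) (hF : IntegrableOn (fun x => U.ρ x * f (U.ρ x) (U.φ x)) Ω) :
    IntegrableOn (energyDensity f γ U) Ω :=
  (hF.add ((((ExtendsToClosure.const (1 / 2)).mul hU.c1_ρ.extendsToClosure).mul
    hU.c1_v.extendsToClosure.norm_sq).integrableOn hb ho.measurableSet)).add
      (((ExtendsToClosure.const (γ / 2)).mul
        hU.c1_σ.extendsToClosure.norm_sq).integrableOn hb ho.measurableSet)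

/-- The force that the momentum equation of a time step from `U` to `V` assigns to the viscous
stress, with the convective terms in the form `ρ ((v · ∇) v - ½ ∇|v|²)`. -/
noncomputable def viscousForce (Δt : ℝ) (U V W : Fields d) (x : E d) : E d :=
  W.ρ x • ((1 / Δt) • (V.v x - U.v x) + fderiv ℝ W.v x (W.v x)
    - (1 / 2 : ℝ) • gradient (fun y => ‖W.v y‖ ^ 2) x + gradient W.τ x)
  - W.μ x • gradient W.φ x

lemma extendsToClosure_viscousForce (ho : IsOpen Ω) (hU : U.IsAdmissible Ω)
    (hV : V.IsAdmissible Ω) (hW : W.IsAdmissible Ω) :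
    ExtendsToClosure Ω (viscousForce Δt U V W) :=
  (hW.c1_ρ.extendsToClosure.smul
    (((((hV.c1_v.extendsToClosure.sub hU.c1_v.extendsToClosure).const_smul _).add
      (hW.c1_v.extendsToClosure_fderiv.clm_apply hW.c1_v.extendsToClosure)).sub
      ((hW.c1_v.norm_sq ho).extendsToClosure_gradient.const_smul _)).add
      hW.c1_τ.extendsToClosure_gradient)).sub
    (hW.c1_μ.extendsToClosure.smul hW.c1_φ.extendsToClosure_gradient)

lemma inner_viscousForce {x : E d} (hv : DifferentiableAt ℝ W.v x) :
    inner ℝ (viscousForce Δt U V W x) (W.v x)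
      = W.ρ x * (1 / Δt * inner ℝ (V.v x - U.v x) (W.v x) + fderiv ℝ W.τ x (W.v x))
        - W.μ x * fderiv ℝ W.φ x (W.v x) := by
  have hconvective : inner ℝ (fderiv ℝ W.v x (W.v x)) (W.v x)
      = 1 / 2 * fderiv ℝ (fun y => ‖W.v y‖ ^ 2) x (W.v x) := by
    rw [fderiv_norm_sq_apply hv, real_inner_comm]
    ring
  simp only [viscousForce, inner_sub_left _ (W.μ x • _), inner_sub_left _ ((1 / 2 : ℝ) • _),
    inner_add_left, real_inner_smul_left, inner_gradient, hconvective]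
  ring

namespace IsTimeStep

lemma isWeakTensorDivergence_viscousForce (hst : IsTimeStep Ω f S γ η Δt U V W)
    (ho : IsOpen Ω) (hb : Bornology.IsBounded Ω) (hU : U.IsAdmissible Ω) (hV : V.IsAdmissible Ω)
    (hW : W.IsAdmissible Ω) :
    IsWeakTensorDivergence Ω (fun x => S (W.φ x) (jacobian W.v x)) (viscousForce Δt U V W) := by
  obtain ⟨D, hMD, hD⟩ := hst.momentum
  refine hMD.congr_ae ?_ ((extendsToClosure_viscousForce ho hU hV hW).integrableOn hb
    ho.measurableSet).locallyIntegrableOn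
  filter_upwards [hD, ae_restrict_mem ho.measurableSet] with x hx hxΩ
  rw [tensorDivergence_smul_tensor (hW.c1_ρ.differentiableAt ho hxΩ)
    (hW.c1_v.differentiableAt ho hxΩ)] at hx
  rw [← sub_eq_zero.1 hx.symm, viscousForce]
  module

lemma integral_inner_viscousForce (hst : IsTimeStep Ω f S γ η Δt U V W)
    (hS : Continuous fun p : ℝ × Matrix (Fin d) (Fin d) ℝ => S p.1 p.2)
    (ho : IsOpen Ω) (hb : Bornology.IsBounded Ω) (hU : U.IsAdmissible Ω) (hV : V.IsAdmissible Ω)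
    (hW : W.IsAdmissible Ω) :
    ∫ x in Ω, inner ℝ (viscousForce Δt U V W x) (W.v x)
      = -∫ x in Ω, frob (S (W.φ x) (jacobian W.v x)) (jacobian W.v x) := by
  have hstress : ExtendsToClosure Ω fun x => S (W.φ x) (jacobian W.v x) :=
    hW.c1_φ.extendsToClosure.comp₂ hS (hW.c1_v.extendsToClosure_jacobian ho)
  exact (hst.isWeakTensorDivergence_viscousForce ho hb hU hV hW).integral_eq_of_frontier_eq_zero
    ho hb ((extendsToClosure_viscousForce ho hU hV hW).integrableOn hb ho.measurableSet)
    (fun i j => (hstress.comp (Φ := fun A : Matrix (Fin d) (Fin d) ℝ => A i j)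
      (continuous_id.matrix_elem i j)).integrableOn hb ho.measurableSet)
    hW.c1_v hW.v_boundary

lemma freeEnergy_sub (hst : IsTimeStep Ω f S γ η Δt U V W) {x : E d} (hx : x ∈ Ω) :
    V.ρ x * f (V.ρ x) (V.φ x) - U.ρ x * f (U.ρ x) (U.φ x)
      = (W.μ x + γ * divergence W.σ x) * (V.φ x - U.φ x)
        + (W.τ x - 1 / 4 * (‖V.v x‖ ^ 2 + ‖U.v x‖ ^ 2)) * (V.ρ x - U.ρ x) := by
  have hphase : (W.μ x + γ * divergence W.σ x) * (V.φ x - U.φ x)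
      = (V.ρ x * f (V.ρ x) (V.φ x) - V.ρ x * f (V.ρ x) (U.φ x)
          + U.ρ x * f (U.ρ x) (V.φ x) - U.ρ x * f (U.ρ x) (U.φ x)) / 2 := by
    rcases eq_or_ne (V.φ x) (U.φ x) with h | h
    · rw [h]; ring
    · have hne : V.φ x - U.φ x ≠ 0 := sub_ne_zero.2 h
      have hpotential := hst.potential x hx h
      field_simp at hpotential
      linarith
  have hdensity : (W.τ x - 1 / 4 * (‖V.v x‖ ^ 2 + ‖U.v x‖ ^ 2)) * (V.ρ x - U.ρ x)
      = (V.ρ x * f (V.ρ x) (V.φ x) - U.ρ x * f (U.ρ x) (V.φ x)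
          + V.ρ x * f (V.ρ x) (U.φ x) - U.ρ x * f (U.ρ x) (U.φ x)) / 2 := by
    rcases eq_or_ne (V.ρ x) (U.ρ x) with h | h
    · rw [h]; ring
    · have hne : V.ρ x - U.ρ x ≠ 0 := sub_ne_zero.2 h
      have hauxiliary := hst.auxiliary x hx h
      field_simp at hauxiliary
      linarith
  rw [hphase, hdensity]
  ring

lemma energyDensity_sub (hst : IsTimeStep Ω f S γ η Δt U V (U.mid V)) (ho : IsOpen Ω)
    (hU : U.IsAdmissible Ω) (hV : V.IsAdmissible Ω) {x : E d} (hx : x ∈ Ω)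
    (hσ : U.σ x = gradient U.φ x) :
    energyDensity f γ V x - energyDensity f γ U x
      = γ * divergence (fun y => (V.φ y - U.φ y) • (U.mid V).σ y) x
        + (U.mid V).μ x * (V.φ x - U.φ x) + (U.mid V).τ x * (V.ρ x - U.ρ x)
        + (U.mid V).ρ x * inner ℝ (V.v x - U.v x) ((U.mid V).v x) := by
  have hgradient : fderiv ℝ (fun y => V.φ y - U.φ y) x ((U.mid V).σ x)
      = 1 / 2 * (‖V.σ x‖ ^ 2 - ‖U.σ x‖ ^ 2) := by
    rw [fderiv_fun_sub (hV.c1_φ.differentiableAt ho hx) (hU.c1_φ.differentiableAt ho hx),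
      sub_apply, ← inner_gradient, ← inner_gradient, ← inner_sub_left, ← hσ,
      ← sub_eq_zero.1 (hst.gradient_eq x hx).symm, Fields.mid, inner_sub_half_smul_add]
  have hvelocity : inner ℝ (V.v x - U.v x) ((U.mid V).v x)
      = 1 / 2 * (‖V.v x‖ ^ 2 - ‖U.v x‖ ^ 2) := inner_sub_half_smul_add _ _
  rw [divergence_smul ((hV.c1_φ.sub ho hU.c1_φ).differentiableAt ho hx)
    ((hU.mid ho hV).c1_σ.differentiableAt ho hx), hgradient, hvelocity,
    show (U.mid V).ρ x = (V.ρ x + U.ρ x) / 2 from rfl, energyDensity, energyDensity]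
  linear_combination hst.freeEnergy_sub hx

lemma power_balance (hst : IsTimeStep Ω f S γ η Δt U V W) (hΔt : Δt ≠ 0) (ho : IsOpen Ω)
    (hW : W.IsAdmissible Ω) {x : E d} (hx : x ∈ Ω) :
    W.μ x * (V.φ x - U.φ x) + W.τ x * (V.ρ x - U.ρ x)
        + W.ρ x * inner ℝ (V.v x - U.v x) (W.v x)
      = -(Δt * (η * (|W.μ x| ^ 2 / W.ρ x) + divergence (fun y => W.τ y • (W.ρ y • W.v y)) x
          - inner ℝ (viscousForce Δt U V W x) (W.v x))) := by
  have hmass := hst.mass x hx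
  have hphase := hst.phase x hx
  have hforce := inner_viscousForce (Δt := Δt) (U := U) (V := V) (hW.c1_v.differentiableAt ho hx)
  rw [inner_gradient] at hphase
  rw [divergence_smul (hW.c1_τ.differentiableAt ho hx)
    ((hW.c1_ρ.smul ho hW.c1_v).differentiableAt ho hx), map_smul, smul_eq_mul, sq_abs, hforce]
  have hφ : Δt * ((V.φ x - U.φ x) / Δt) = V.φ x - U.φ x := mul_div_cancel₀ _ hΔt
  have hρ : Δt * ((V.ρ x - U.ρ x) / Δt) = V.ρ x - U.ρ x := mul_div_cancel₀ _ hΔt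
  have hv : Δt * (1 / Δt) = 1 := mul_one_div_cancel hΔt
  linear_combination -(Δt * W.μ x) * hphase - (Δt * W.τ x) * hmass - W.μ x * hφ - W.τ x * hρ
    - W.ρ x * inner ℝ (V.v x - U.v x) (W.v x) * hv

/-- Since `ρ` may vanish on the boundary, the continuity of `μ² / ρ` is read off the phase
equation. -/
lemma extendsToClosure_mobility (hst : IsTimeStep Ω f S γ η Δt U V W) (hU : U.IsAdmissible Ω)
    (hV : V.IsAdmissible Ω) (hW : W.IsAdmissible Ω) :
    ExtendsToClosure Ω (fun x => η * (|W.μ x| ^ 2 / W.ρ x)) := by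
  refine (hW.c1_μ.extendsToClosure.mul (((hV.c1_φ.extendsToClosure.sub
    hU.c1_φ.extendsToClosure).const_smul (-Δt⁻¹)).sub (hW.c1_φ.extendsToClosure_gradient.inner
      hW.c1_v.extendsToClosure))).congr fun x hx => ?_
  simp only [sq_abs, smul_eq_mul]
  linear_combination (-W.μ x) * hst.phase x hx

lemma integrableOn_dissipationDensity (hst : IsTimeStep Ω f S γ η Δt U V W)
    (hS : Continuous fun p : ℝ × Matrix (Fin d) (Fin d) ℝ => S p.1 p.2)
    (ho : IsOpen Ω) (hb : Bornology.IsBounded Ω) (hU : U.IsAdmissible Ω) (hV : V.IsAdmissible Ω)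
    (hW : W.IsAdmissible Ω) : IntegrableOn (dissipationDensity S η W) Ω := by
  have hjacobian := hW.c1_v.extendsToClosure_jacobian ho
  exact (((hW.c1_φ.extendsToClosure.comp₂ hS hjacobian).frob hjacobian).add
    (hst.extendsToClosure_mobility hU hV hW)).integrableOn hb ho.measurableSet

lemma energyDensity_eq (hst : IsTimeStep Ω f S γ η Δt U V (U.mid V)) (hΔt : Δt ≠ 0)
    (ho : IsOpen Ω) (hU : U.IsAdmissible Ω) (hV : V.IsAdmissible Ω)
    (hσ : ∀ x ∈ Ω, U.σ x = gradient U.φ x) {x : E d} (hx : x ∈ Ω) :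
    energyDensity f γ V x = energyDensity f γ U x
      + (γ * divergence (fun y => (V.φ y - U.φ y) • (U.mid V).σ y) x
        - Δt * (η * (|(U.mid V).μ x| ^ 2 / (U.mid V).ρ x)
          + divergence (fun y => (U.mid V).τ y • ((U.mid V).ρ y • (U.mid V).v y)) x
          - inner ℝ (viscousForce Δt U V (U.mid V) x) ((U.mid V).v x))) := by
  linear_combination hst.energyDensity_sub ho hU hV hx (hσ x hx)
    + hst.power_balance hΔt ho (hU.mid ho hV) hx

lemma integral_power_eq (hst : IsTimeStep Ω f S γ η Δt U V W) (hd : 1 ≤ d)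
    (hΩ : IsAdmissibleDomain Ω)
    (hS : Continuous fun p : ℝ × Matrix (Fin d) (Fin d) ℝ => S p.1 p.2)
    (hU : U.IsAdmissible Ω) (hV : V.IsAdmissible Ω) (hW : W.IsAdmissible Ω) :
    IntegrableOn (fun x => η * (|W.μ x| ^ 2 / W.ρ x)
        + divergence (fun y => W.τ y • (W.ρ y • W.v y)) x
        - inner ℝ (viscousForce Δt U V W x) (W.v x)) Ω ∧
      ∫ x in Ω, (η * (|W.μ x| ^ 2 / W.ρ x) + divergence (fun y => W.τ y • (W.ρ y • W.v y)) x
        - inner ℝ (viscousForce Δt U V W x) (W.v x)) = ∫ x in Ω, dissipationDensity S η W x := by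
  have ho := hΩ.isOpen
  have integrableOn {u : E d → ℝ} (hu : ExtendsToClosure Ω u) : IntegrableOn u Ω :=
    hu.integrableOn hΩ.isBounded ho.measurableSet
  have hpressure : IsC1Closure Ω fun x => W.τ x • (W.ρ x • W.v x) :=
    hW.c1_τ.smul ho (hW.c1_ρ.smul ho hW.c1_v)
  have hpressure_zero := hΩ.integral_divergence_eq_zero hd hpressure
    fun x hx n _ => by simp [hW.v_boundary x hx]
  have hpressure_int := integrableOn (hpressure.extendsToClosure_divergence ho)
  have hmobility_int := integrableOn (hst.extendsToClosure_mobility hU hV hW)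
  have hforce_int := integrableOn ((extendsToClosure_viscousForce (Δt := Δt) ho hU hV hW).inner
    hW.c1_v.extendsToClosure)
  have hjacobian := hW.c1_v.extendsToClosure_jacobian ho
  have hstress_int := integrableOn ((hW.c1_φ.extendsToClosure.comp₂ hS hjacobian).frob hjacobian)
  have hdissipation : ∫ x in Ω, dissipationDensity S η W x
      = (∫ x in Ω, frob (S (W.φ x) (jacobian W.v x)) (jacobian W.v x))
        + ∫ x in Ω, η * (|W.μ x| ^ 2 / W.ρ x) := integral_add hstress_int hmobility_int
  refine ⟨(hmobility_int.fun_add hpressure_int).fun_sub hforce_int, ?_⟩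
  rw [integral_sub (hmobility_int.fun_add hpressure_int) hforce_int,
    integral_add hmobility_int hpressure_int, hpressure_zero,
    hst.integral_inner_viscousForce hS ho hΩ.isBounded hU hV hW, hdissipation]
  ring

theorem integral_energyDensity (hst : IsTimeStep Ω f S γ η Δt U V (U.mid V)) (hd : 1 ≤ d)
    (hΩ : IsAdmissibleDomain Ω)
    (hS : Continuous fun p : ℝ × Matrix (Fin d) (Fin d) ℝ => S p.1 p.2) (hΔt : Δt ≠ 0)
    (hU : U.IsAdmissible Ω) (hV : V.IsAdmissible Ω) (hσ : ∀ x ∈ Ω, U.σ x = gradient U.φ x)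
    (hE : IntegrableOn (energyDensity f γ U) Ω) :
    IntegrableOn (energyDensity f γ V) Ω ∧
      ∫ x in Ω, energyDensity f γ V x = (∫ x in Ω, energyDensity f γ U x)
        - Δt * ∫ x in Ω, dissipationDensity S η (U.mid V) x := by
  have ho := hΩ.isOpen
  have hW := hU.mid ho hV
  have hcapillary : IsC1Closure Ω fun x => (V.φ x - U.φ x) • (U.mid V).σ x :=
    (hV.c1_φ.sub ho hU.c1_φ).smul ho hW.c1_σ
  have hcapillary_zero := hΩ.integral_divergence_eq_zero hd hcapillary
    (IsTangential.smul hW.σ_boundary _)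
  have hcapillary_int := ((hcapillary.extendsToClosure_divergence ho).integrableOn
    (μ := volume) hΩ.isBounded ho.measurableSet).const_mul γ
  obtain ⟨hpower_int, hpower⟩ := hst.integral_power_eq hd hΩ hS hU hV hW
  have hpower_int' := hpower_int.const_mul Δt
  have hEV : EqOn (energyDensity f γ V) _ Ω := fun x hx => hst.energyDensity_eq hΔt ho hU hV hσ hx
  have hchange_int := IntegrableOn.fun_sub hcapillary_int hpower_int'
  refine ⟨(hE.fun_add hchange_int).congr_fun hEV.symm ho.measurableSet, ?_⟩
  rw [setIntegral_congr_fun ho.measurableSet hEV, integral_add hE hchange_int,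
    integral_sub hcapillary_int hpower_int',
    integral_const_mul, integral_const_mul, hcapillary_zero, hpower]
  ring

end IsTimeStep

namespace IsTimeDiscreteSolution

variable {N : ℕ} {t : ℕ → ℝ} {U : ℕ → Fields d}

lemma σ_eq_gradient (hU : IsTimeDiscreteSolution Ω f S γ η N t U) {n : ℕ} (hn : n ≤ N) {x : E d}
    (hx : x ∈ Ω) : (U n).σ x = gradient (U n).φ x := by
  rcases n with _ | n
  · exact hU.initial_σ x hx
  · exact sub_eq_zero.1 ((hU.step n hn).gradient_eq x hx).symm

lemma integral_energyDensity_succ (hU : IsTimeDiscreteSolution Ω f S γ η N t U) (hd : 1 ≤ d)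
    (hΩ : IsAdmissibleDomain Ω)
    (hS : Continuous fun p : ℝ × Matrix (Fin d) (Fin d) ℝ => S p.1 p.2) {n : ℕ} (hn : n < N)
    (hE : IntegrableOn (energyDensity f γ (U n)) Ω) :
    IntegrableOn (energyDensity f γ (U (n + 1))) Ω ∧
      ∫ x in Ω, energyDensity f γ (U (n + 1)) x = (∫ x in Ω, energyDensity f γ (U n) x)
        - (t (n + 1) - t n) * ∫ x in Ω, dissipationDensity S η ((U n).mid (U (n + 1))) x :=
  (hU.step n hn).integral_energyDensity hd hΩ hS (sub_ne_zero.2 (hU.time_lt n hn).ne')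
    (hU.admissible n hn.le) (hU.admissible (n + 1) hn) (fun _ => hU.σ_eq_gradient hn.le) hE

lemma integrableOn_dissipationDensity (hU : IsTimeDiscreteSolution Ω f S γ η N t U)
    (ho : IsOpen Ω) (hb : Bornology.IsBounded Ω)
    (hS : Continuous fun p : ℝ × Matrix (Fin d) (Fin d) ℝ => S p.1 p.2) {n : ℕ} (hn : n < N) :
    IntegrableOn (dissipationDensity S η ((U n).mid (U (n + 1)))) Ω :=
  have hn₀ := hU.admissible n hn.le
  have hn₁ := hU.admissible (n + 1) hn
  (hU.step n hn).integrableOn_dissipationDensity hS ho hb hn₀ hn₁ (hn₀.mid ho hn₁)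

end IsTimeDiscreteSolution

end OneStep

end NSAC

theorem mainTheorem3 {d : ℕ} (hd : 1 ≤ d) {Ω : Set (NSAC.E d)} (hΩ : NSAC.IsAdmissibleDomain Ω)
    (f : ℝ → ℝ → ℝ)
    (S : ℝ → Matrix (Fin d) (Fin d) ℝ → Matrix (Fin d) (Fin d) ℝ)
    (hS : Continuous fun p : ℝ × Matrix (Fin d) (Fin d) ℝ => S p.1 p.2)
    (γ η : ℝ) (N : ℕ) (t : ℕ → ℝ) (U : ℕ → NSAC.Fields d)
    (hU : NSAC.IsTimeDiscreteSolution Ω f S γ η N t U)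
    (hinit : IntegrableOn (fun x => (U 0).ρ x * f ((U 0).ρ x) ((U 0).φ x)) Ω) :
    ∀ n ≤ N,
      IntegrableOn (NSAC.energyDensity f γ (U n)) Ω ∧
      (∀ j < n, IntegrableOn (NSAC.dissipationDensity S η ((U j).mid (U (j + 1)))) Ω) ∧
      ∫ x in Ω, NSAC.energyDensity f γ (U n) x =
        (∫ x in Ω, NSAC.energyDensity f γ (U 0) x)
          - ∑ j ∈ Finset.range n, (t (j + 1) - t j) *
              ∫ x in Ω, NSAC.dissipationDensity S η ((U j).mid (U (j + 1))) x := by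
  have hstep {n : ℕ} := hU.integral_energyDensity_succ hd hΩ hS (n := n)
  have hE₀ : IntegrableOn (NSAC.energyDensity f γ (U 0)) Ω :=
    (hU.admissible 0 N.zero_le).integrableOn_energyDensity hΩ.isOpen hΩ.isBounded hinit
  intro n hn
  have hdissipation : ∀ j < n,
      IntegrableOn (NSAC.dissipationDensity S η ((U j).mid (U (j + 1)))) Ω := fun j hj =>
    hU.integrableOn_dissipationDensity hΩ.isOpen hΩ.isBounded hS (hj.trans_le hn)
  suffices henergy : IntegrableOn (NSAC.energyDensity f γ (U n)) Ω ∧ _ from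
    ⟨henergy.1, hdissipation, henergy.2⟩
  clear hdissipation
  induction n with
  | zero => exact ⟨hE₀, by simp⟩
  | succ n ih =>
    obtain ⟨hE, heq⟩ := ih (Nat.le_of_succ_le hn)
    obtain ⟨hE', heq'⟩ := hstep hn hE
    exact ⟨hE', by rw [heq', heq, Finset.sum_range_succ, sub_sub]⟩
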